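/- Let $d\ge 3$ and $d\le m<2d-2$ be integers and let $\mathbf p=(p_0,\dots,p_m)$ be a probability vector with $0<p_0\le p_m\le p_i$ for $1\le i\le m-1$. Put $\delta=-1/\log d$, $\xi=m/(d-1)$ and $\mathcal A=\{0,\dots,m\}$, write $\pi(\omega)=\sum_{i\ge1}\omega_i d^{-i}$ for finite or infinite words over $\mathcal A$, and let $\mu$ be the self-similar measure of the weighted IFS $\{(x/d+i/d,\,p_i)\}_{0\le i\le m}$, i.e. the image under $\pi$ of the Bernoulli measure with weights $\mathbf p$ on $\mathcal A^{\mathbb N}$. For $\sigma\in\mathcal A^k$ let $\eta(\sigma)=\sum\{p_{\sigma'_1}\cdots p_{\sigma'_k}:\sigma'\in\mathcal A^k,\ \pi(\sigma')=\pi(\sigma)\}$, and let $\Xi_k\subset\mathcal A^k$ contain exactly one word from each class of words of length $k$ with the same value of $\pi$. Let $w\in\mathcal A^\ell$ be a barrier word, i.e. $\pi(\omega)-1<0<\xi<\pi(\omega)+1$ for every infinite word $\omega$ beginning with $w$ (for $\ell=1$, $w=(b)$ is a barrier digit), and put $\hat S_k(q)=\sum_{\sigma\in\Xi_{k-\ell}}\eta(w,\sigma)^q$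 for $k\ge\ell$, where $(w,\sigma)$ denotes concatenation. Let $a=1+\lfloor (m-d)/(d-1)\rfloor$ and let $M_i$, $0\le i\le m$, be the matrices indexed by $\{-a,\dots,a\}^2$ with entries $M_i(k,l)=p_{-ld+k+i}$, where $p_j=0$ for $j\notin\{0,\dots,m\}$. For $\sigma\in\mathcal A^k$ put $M(\sigma)=M_{\sigma_k}\cdots M_{\sigma_1}$. With $\rho$ the spectral radius, let $$\alpha^*=\delta\log\inf\{\rho(M(\sigma))^{1/|\sigma|}:\sigma\in\mathcal A^k,\ k\ge1,\ \sigma_1\notin\{0,m\}\},\qquad \overline\alpha=\delta\log p_0 .$$ The $L^q$-spectrum of a compactly supported measure $\lambda$ on $\mathbb R$ is $\lim_{r\to0^+}\log S_{\lambda,r}(q)/\log r$, when this limit exists for all $q\in\mathbb R$, where $S_{\lambda,r}(q)$ is the supremum of $\sum_i\lambda(B(x_i,r))^q$ over all families of pairwise disjoint balls $B(x_i,r)$ centred in $\operatorname{supp}\lambda$. Then: 1. For every $q\in\mathbb R$ the limit $\hat\tau(q)=\lim_{k\to\infty}\delta k^{-1}\log\hat S_k(q)$ exists and is finite, and it equals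 $\inf_{k\ge\ell}\delta k^{-1}\log\hat S_k(q)$. 2. For every closed interval $K=[u,v]$ with $0<u<v<\xi$, the $L^q$-spectrum of the restriction $\mu|_K$ exists and equals $\hat\tau$. 3. The $L^q$-spectrum $\tau$ of $\mu$ exists. If $\alpha^*=\overline\alpha$, then $\tau(q)=\hat\tau(q)$ for all $q\in\mathbb R$. If $\alpha^*<\overline\alpha$, then there is $q_0\in(-\infty,0)$ such that $\tau(q)=\overline\alpha q$ for $q\le q_0$ and $\tau(q)=\hat\tau(q)$ for $q>q_0$. -/

import Mathlib

open MeasureTheory Filter Topology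
open scoped ENNReal

/-! The self-similar measure of the weighted iterated function system
`{ (x / d + i / d, p i) : 0 ≤ i ≤ m }`, its transfer matrices and its `L^q`-spectrum.
The digits are the elements of `Fin (m + 1)`, a word of length `k` is a function
`Fin k → Fin (m + 1)`, and the probability vector is `p : PMF (Fin (m + 1))`. -/

namespace OverlapIFS

noncomputable section

/-- The constant `δ = -1 / log d`. -/
def delta (d : ℕ) : ℝ := -1 / Real.log d

/-- The right endpoint `ξ = m / (d - 1)` of the attractor. -/
def xi (d m : ℕ) : ℝ := (m : ℝ) / ((d : ℝ) - 1)

/-- The weight `p_i` as a real number. -/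
def weight {m : ℕ} (p : PMF (Fin (m + 1))) (i : Fin (m + 1)) : ℝ := (p i).toReal

/-- The weight `p_j` for an arbitrary integer `j`, with `p_j = 0` outside `{0, …, m}`. -/
def weightExt {m : ℕ} (p : PMF (Fin (m + 1))) (j : ℤ) : ℝ :=
  if h : 0 ≤ j ∧ j ≤ m then weight p ⟨j.toNat, by omega⟩ else 0

/-- The projection `π(ω) = ∑_{i ≥ 1} ω_i d^{-i}` of an infinite word (here the letters are
indexed from `0`). -/
def proj (d : ℕ) {m : ℕ} (ω : ℕ → Fin (m + 1)) : ℝ :=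
  ∑' i : ℕ, ((ω i : ℕ) : ℝ) / (d : ℝ) ^ (i + 1)

/-- The projection `π(σ) = ∑_{i = 1}^{k} σ_i d^{-i}` of a finite word. -/
def projFin (d : ℕ) {m k : ℕ} (σ : Fin k → Fin (m + 1)) : ℝ :=
  ∑ i : Fin k, ((σ i : ℕ) : ℝ) / (d : ℝ) ^ ((i : ℕ) + 1)

/-- The Bernoulli measure on infinite words. -/
def bernoulli {m : ℕ} (p : PMF (Fin (m + 1))) : Measure (ℕ → Fin (m + 1)) :=
  Measure.infinitePi fun _ : ℕ => p.toMeasure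

/-- The self-similar measure `μ`: the image of the Bernoulli measure under `π`. -/
def selfSimilar (d : ℕ) {m : ℕ} (p : PMF (Fin (m + 1))) : Measure ℝ :=
  (bernoulli p).map (proj d)

/-- `𝐩(σ)`, the product of the weights of the letters of `σ`. -/
def wordWeight {m : ℕ} (p : PMF (Fin (m + 1))) {k : ℕ} (σ : Fin k → Fin (m + 1)) : ℝ :=
  ∏ j : Fin k, weight p (σ j)

open Classical in
/-- `η(σ)`, the sum of `𝐩(σ')` over the words `σ'` of the same length with `π(σ') = π(σ)`. -/
def eta (d : ℕ) {m : ℕ} (p : PMF (Fin (m + 1))) {k : ℕ} (σ : Fin k → Fin (m + 1)) : ℝ :=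
  ∑ σ' : Fin k → Fin (m + 1) with projFin d σ' = projFin d σ, wordWeight p σ'

/-- `Ξ_k` consists of exactly one word out of each nonempty class
`{σ : |σ| = k, π(σ) = s}`, for every `k`. -/
def IsRepresentativeFamily (d m : ℕ) (Ξ : (k : ℕ) → Finset (Fin k → Fin (m + 1))) : Prop :=
  ∀ k : ℕ, Set.BijOn (projFin d) (Ξ k : Set (Fin k → Fin (m + 1)))
    (Set.range (projFin d : (Fin k → Fin (m + 1)) → ℝ))

/-- `w` is a barrier word: `π(ω) - 1 < 0 < ξ < π(ω) + 1` for every infinite word `ω` that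
begins with `w`. For `ℓ = 1` this says that the digit `w 0` is a barrier digit. -/
def IsBarrier (d : ℕ) {m ℓ : ℕ} (w : Fin ℓ → Fin (m + 1)) : Prop :=
  ∀ ω : ℕ → Fin (m + 1), (∀ i : Fin ℓ, ω i = w i) →
    proj d ω - 1 < 0 ∧ 0 < xi d m ∧ xi d m < proj d ω + 1

/-- The sum of `η(w, σ)^q` over the representatives `σ ∈ Ξ_n`. When the barrier word `w` has
length `ℓ`, this is the quantity `Ŝ_k(q)` for `k = ℓ + n`. -/
def Shat (d : ℕ) {m ℓ : ℕ} (p : PMF (Fin (m + 1))) (w : Fin ℓ → Fin (m + 1))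
    (Ξ : (k : ℕ) → Finset (Fin k → Fin (m + 1))) (n : ℕ) (q : ℝ) : ℝ :=
  ∑ σ ∈ Ξ n, eta d p (Fin.append w σ) ^ q

/-- `a = 1 + ⌊(m - d) / (d - 1)⌋` (used for `d ≤ m`). -/
def halfWidth (d m : ℕ) : ℕ := 1 + (m - d) / (d - 1)

/-- The index set `{-a, …, a}` of the transfer matrices. -/
abbrev MatIdx (d m : ℕ) : Type :=
  {k : ℤ // k ∈ Finset.Icc (-(halfWidth d m : ℤ)) (halfWidth d m : ℤ)}

/-- The transfer matrix `M_i(k, l) = p_{-ld + k + i}`. -/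
def transfer (d : ℕ) {m : ℕ} (p : PMF (Fin (m + 1))) (i : Fin (m + 1)) :
    Matrix (MatIdx d m) (MatIdx d m) ℝ :=
  Matrix.of fun k l => weightExt p (-(l : ℤ) * (d : ℤ) + (k : ℤ) + ((i : ℕ) : ℤ))

/-- `M(σ) = M_{σ(k)} ⋯ M_{σ(1)}`. -/
def transferWord (d : ℕ) {m : ℕ} (p : PMF (Fin (m + 1))) {k : ℕ} (σ : Fin k → Fin (m + 1)) :
    Matrix (MatIdx d m) (MatIdx d m) ℝ :=
  ((List.ofFn fun j => transfer d p (σ j)).reverse).prod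

/-- The spectral radius of a real square matrix: the maximal modulus of its complex
eigenvalues. -/
def rho {ι : Type} [Fintype ι] [DecidableEq ι] (A : Matrix ι ι ℝ) : ℝ :=
  (spectralRadius ℂ (A.map (fun x : ℝ => (x : ℂ)))).toReal

/-- The infimum of `ρ(M(σ))^{1/|σ|}` over the nonempty words with `σ_1 ∉ {0, m}`. -/
def rhoLower (d : ℕ) {m : ℕ} (p : PMF (Fin (m + 1))) : ℝ :=
  sInf {x : ℝ | ∃ (k : ℕ) (σ : Fin (k + 1) → Fin (m + 1)), σ 0 ≠ 0 ∧ σ 0 ≠ Fin.last m ∧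
    x = rho (transferWord d p σ) ^ (1 / ((k : ℝ) + 1))}

/-- `α^*`. -/
def alphaStar (d : ℕ) {m : ℕ} (p : PMF (Fin (m + 1))) : ℝ :=
  delta d * Real.log (rhoLower d p)

/-- `ᾱ = δ log p_0`. -/
def alphaBar (d : ℕ) {m : ℕ} (p : PMF (Fin (m + 1))) : ℝ :=
  delta d * Real.log (weight p 0)

/-- The supremum of `∑ᵢ μ(B(xᵢ, r))^q` over the packings of the support of `μ`, that is, over
the finite families of pairwise disjoint closed balls of radius `r` centred in the support. -/
def packingSum (μ : Measure ℝ) (r q : ℝ) : ℝ≥0∞ :=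
  ⨆ (t : Finset ℝ) (_ : (t : Set ℝ) ⊆ μ.support)
    (_ : (t : Set ℝ).PairwiseDisjoint fun x => Metric.closedBall x r),
    ∑ x ∈ t, μ (Metric.closedBall x r) ^ q

/-- `τ` is the `L^q`-spectrum of `μ`: for every `q` the limit of
`log S_{μ,r}(q) / log r` as `r → 0+` exists and equals the real number `τ q`. -/
def IsLqSpectrum (μ : Measure ℝ) (τ : ℝ → ℝ) : Prop :=
  ∀ q : ℝ, Tendsto (fun r : ℝ => ENNReal.log (packingSum μ r q) / ((Real.log r : ℝ) : EReal))
    (𝓝[>] (0 : ℝ)) (𝓝 ((τ q : ℝ) : EReal))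

end

end OverlapIFS

/-! Everything is read off the masses `mass d p k j`, the probability that the first k letters have
integer value j = d^k π(σ). Since 1 < ξ < 2, a suffix carries at most one unit into its prefix: a
value d^k t + y with 0 ≤ y < d^k is reached only from the prefix values t and t - 1 (`mass_add`).
Neighbouring masses of level k differ by a factor at most linear in k (`mass_neighbour`). So a ball
of radius about d^(-k) has the measure of a single mass up to subexponential factors, and the
spectrum on [u, v] is δ times the growth rate of the q-th power sum of the masses over a `window`
(`tendsto_packingSum`).

Interior: if t and t - 1 are both values of words of length s, their masses lie between p_0^s and 1,
so the mass of d^k t + y is comparable to `foldMass` at y, whatever t is. Hence all intervals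
compactly inside (0, ξ) share one growth rate P(q), that of `foldSum`. A barrier word provides a
window inside (ξ - 1, 1), where the carry disappears and masses multiply exactly; the power sums are
then supermultiplicative, and Fekete's lemma gives P(q) as a limit and a supremum. The sign δ < 0
turns the supremum into the infimum of part 1, with τhat = δ P.

Whole measure: at each level the two end blocks are copies of parts of the previous level scaled by
p_0 and p_m, and the rest is interior. This recursion gives the rate max(P(q), q log p_0)
(`tendsto_fullSum`), that is, τ(q) is the minimum of τhat(q) and ᾱ q.

Comparison: the entries of M(σ) are masses near the value of σ (`transferList_apply`), which ties
spectral radii to folded masses. With ρ_* = `rhoLower` one gets q log ρ_* ≤ P(q) ≤ log d + q log ρ_*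
for q < 0, while P(q) ≥ q log p_0 for q ≥ 0. If ρ_* = p_0, the maximum is always P. If ρ_* > p_0,
the upper bound puts P below the line q log p_0 for very negative q; as P(q) - q log p_0 is
nondecreasing and P(0) = log d > 0, there is one threshold, and it is negative. -/

namespace OverlapIFS

noncomputable section

variable {d m : ℕ} {p : PMF (Fin (m + 1))}

/-- The standing assumptions on the integers `d`, `m` and the weights `p`. -/
structure Admissible (d m : ℕ) (p : PMF (Fin (m + 1))) : Prop where
  three_le : 3 ≤ d
  le : d ≤ m
  lt : m + 2 < 2 * d
  pos : 0 < p 0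
  first_le_last : p 0 ≤ p (Fin.last m)
  last_le : ∀ i : Fin (m + 1), i ≠ 0 → i ≠ Fin.last m → p (Fin.last m) ≤ p i

/-! ### Weights -/

lemma weightExt_natCast {j : ℕ} (hj : j ≤ m) :
    weightExt p (j : ℤ) = weight p ⟨j, by omega⟩ := by
  unfold weightExt
  rw [dif_pos (by omega)]
  rfl

lemma weightExt_fin (i : Fin (m + 1)) : weightExt p ((i : ℕ) : ℤ) = weight p i :=
  weightExt_natCast (by omega)

lemma weightExt_of_neg {j : ℤ} (hj : j < 0) : weightExt p j = 0 := by
  unfold weightExt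
  rw [dif_neg (by omega)]

lemma weightExt_of_gt {j : ℤ} (hj : (m : ℤ) < j) : weightExt p j = 0 := by
  unfold weightExt
  rw [dif_neg (by omega)]

lemma weight_nonneg (i : Fin (m + 1)) : 0 ≤ weight p i := ENNReal.toReal_nonneg

lemma weight_le_one (i : Fin (m + 1)) : weight p i ≤ 1 := by
  unfold weight
  exact ENNReal.toReal_le_of_le_ofReal zero_le_one (by simpa using p.coe_le_one i)

lemma weightExt_nonneg (j : ℤ) : 0 ≤ weightExt p j := by
  unfold weightExt
  split_ifs
  · exact weight_nonneg _
  · exact le_rfl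

lemma weightExt_le_one (j : ℤ) : weightExt p j ≤ 1 := by
  unfold weightExt
  split_ifs
  · exact weight_le_one _
  · exact zero_le_one

lemma sum_weight : ∑ i : Fin (m + 1), weight p i = 1 := by
  unfold weight
  rw [← ENNReal.toReal_sum (fun i _ => p.apply_ne_top i)]
  have h := p.tsum_coe
  rw [tsum_fintype] at h
  simp [h]

lemma weight_pos_zero (h : Admissible d m p) : 0 < weight p 0 :=
  ENNReal.toReal_pos h.pos.ne' (p.apply_ne_top 0)

lemma weight_zero_le_last (h : Admissible d m p) : weight p 0 ≤ weight p (Fin.last m) :=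
  ENNReal.toReal_mono (p.apply_ne_top _) h.first_le_last

lemma weight_last_le (h : Admissible d m p) {j : ℤ} (h1 : 1 ≤ j) (h2 : j ≤ m) :
    weight p (Fin.last m) ≤ weightExt p j := by
  lift j to ℕ using by omega
  rw [weightExt_natCast (by omega)]
  rcases eq_or_ne j m with rfl | hne
  · exact le_rfl
  · refine ENNReal.toReal_mono (p.apply_ne_top _) (h.last_le _ ?_ ?_)
    · simp [Fin.ext_iff]; omega
    · simpa [Fin.ext_iff] using hne

lemma weight_zero_le (h : Admissible d m p) {j : ℤ} (h1 : 0 ≤ j) (h2 : j ≤ m) :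
    weight p 0 ≤ weightExt p j := by
  rcases h1.eq_or_lt with rfl | h1
  · exact (weightExt_fin (p := p) 0).ge
  · exact (weight_zero_le_last h).trans (weight_last_le h h1 h2)

/-! ### Integer values of words -/

/-- The integer `d ^ k * π(σ)` for a word `σ` of length `k`. -/
def wordVal (d : ℕ) {m k : ℕ} (σ : Fin k → Fin (m + 1)) : ℤ :=
  ∑ i : Fin k, ((σ i : ℕ) : ℤ) * (d : ℤ) ^ (k - 1 - (i : ℕ))

lemma projFin_mul_pow (hd : d ≠ 0) {k : ℕ} (σ : Fin k → Fin (m + 1)) :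
    projFin d σ * (d : ℝ) ^ k = (wordVal d σ : ℝ) := by
  unfold projFin wordVal
  push_cast
  rw [Finset.sum_mul]
  refine Finset.sum_congr rfl fun i _ => ?_
  have hd' : (d : ℝ) ≠ 0 := by exact_mod_cast hd
  have hk : (d : ℝ) ^ k = (d : ℝ) ^ ((i : ℕ) + 1) * (d : ℝ) ^ (k - 1 - (i : ℕ)) := by
    rw [← pow_add]
    congr 1
    omega
  rw [hk]
  field_simp

lemma projFin_eq (hd : d ≠ 0) {k : ℕ} (σ : Fin k → Fin (m + 1)) :
    projFin d σ = (wordVal d σ : ℝ) / (d : ℝ) ^ k := by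
  have hd' : (d : ℝ) ^ k ≠ 0 := pow_ne_zero _ (by exact_mod_cast hd)
  rw [eq_div_iff hd', projFin_mul_pow hd]

lemma projFin_eq_iff (hd : d ≠ 0) {k : ℕ} (σ σ' : Fin k → Fin (m + 1)) :
    projFin d σ = projFin d σ' ↔ wordVal d σ = wordVal d σ' := by
  have hd' : (d : ℝ) ^ k ≠ 0 := pow_ne_zero _ (by exact_mod_cast hd)
  rw [projFin_eq hd, projFin_eq hd, div_left_inj' hd', Int.cast_inj]

lemma wordVal_append {s k : ℕ} (a : Fin s → Fin (m + 1)) (b : Fin k → Fin (m + 1)) :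
    wordVal d (Fin.append a b) = (d : ℤ) ^ k * wordVal d a + wordVal d b := by
  unfold wordVal
  rw [Fin.sum_univ_add, Finset.mul_sum]
  congr 1
  · refine Finset.sum_congr rfl fun i _ => ?_
    rw [Fin.append_left, Fin.val_castAdd, mul_left_comm, ← pow_add]
    congr 2
    omega
  · refine Finset.sum_congr rfl fun i _ => ?_
    rw [Fin.append_right, Fin.val_natAdd]
    congr 2
    omega

lemma wordWeight_append {s k : ℕ} (a : Fin s → Fin (m + 1)) (b : Fin k → Fin (m + 1)) :
    wordWeight p (Fin.append a b) = wordWeight p a * wordWeight p b := by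
  simp [wordWeight, Fin.prod_univ_add]

lemma wordWeight_nonneg {k : ℕ} (σ : Fin k → Fin (m + 1)) : 0 ≤ wordWeight p σ :=
  Finset.prod_nonneg fun _ _ => weight_nonneg _

lemma sum_wordWeight (k : ℕ) : ∑ σ : Fin k → Fin (m + 1), wordWeight p σ = 1 := by
  unfold wordWeight
  rw [← Fintype.piFinset_univ, ← Finset.prod_univ_sum]
  simp [sum_weight]

/-- The largest value `ξ (d ^ k - 1)` of a word of length `k`. -/
def top (d m k : ℕ) : ℤ := m * ∑ i ∈ Finset.range k, (d : ℤ) ^ i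

lemma top_zero : top d m 0 = 0 := by simp [top]

lemma top_succ (k : ℕ) : top d m (k + 1) = d * top d m k + m := by
  simp only [top, geom_sum_succ]
  ring

lemma top_succ' (k : ℕ) : top d m (k + 1) = m * d ^ k + top d m k := by
  simp only [top, Finset.sum_range_succ]
  ring

lemma top_mul (k : ℕ) : top d m k * ((d : ℤ) - 1) = m * ((d : ℤ) ^ k - 1) := by
  rw [top, mul_assoc, geom_sum_mul]

lemma top_nonneg (k : ℕ) : 0 ≤ top d m k := by
  unfold top
  positivity

lemma top_eq_xi (hd : 3 ≤ d) (k : ℕ) : (top d m k : ℝ) = xi d m * ((d : ℝ) ^ k - 1) := by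
  have h := top_mul (d := d) (m := m) k
  have h' : (top d m k : ℝ) * ((d : ℝ) - 1) = m * ((d : ℝ) ^ k - 1) := by exact_mod_cast h
  have hd' : (3 : ℝ) ≤ d := by exact_mod_cast hd
  have : (d : ℝ) - 1 ≠ 0 := by linarith
  rw [xi]
  field_simp
  linarith

lemma xi_bounds (h : Admissible d m p) : 1 < xi d m ∧ xi d m < 2 := by
  have h1 := h.three_le
  have h2 := h.le
  have h3 := h.lt
  have hd : (3 : ℝ) ≤ d := by exact_mod_cast h1
  have hm : (d : ℝ) ≤ m := by exact_mod_cast h2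
  have hm' : (m : ℝ) + 2 < 2 * d := by exact_mod_cast h3
  unfold xi
  constructor
  · rw [one_lt_div (by linarith)]; linarith
  · rw [div_lt_iff₀ (by linarith)]; linarith

/-- Since ξ < 2, that is m < 2d - 2, a suffix of length k carries at most one unit into the prefix.
-/
lemma top_lt (h : Admissible d m p) (k : ℕ) : top d m k < 2 * (d : ℤ) ^ k := by
  have hb := xi_bounds h
  have hp : (1 : ℝ) ≤ (d : ℝ) ^ k :=
    one_le_pow₀ (by have := h.three_le; exact_mod_cast (by omega : 1 ≤ d))
  have : (top d m k : ℝ) < 2 * (d : ℝ) ^ k := by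
    rw [top_eq_xi h.three_le]
    nlinarith
  exact_mod_cast this

/-- Since ξ > 1, every residue modulo d^k lies in the range of the values of words of length k. -/
lemma pow_le_top_add_one (h : Admissible d m p) (k : ℕ) : (d : ℤ) ^ k ≤ top d m k + 1 := by
  have hb := xi_bounds h
  have hp : (1 : ℝ) ≤ (d : ℝ) ^ k :=
    one_le_pow₀ (by have := h.three_le; exact_mod_cast (by omega : 1 ≤ d))
  have : (d : ℝ) ^ k ≤ top d m k + 1 := by
    rw [top_eq_xi h.three_le]
    nlinarith
  exact_mod_cast this

lemma pow_pos_int (h : Admissible d m p) (k : ℕ) : (0 : ℤ) < (d : ℤ) ^ k := by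
  have := h.three_le
  positivity

lemma one_le_pow_real (h : Admissible d m p) (k : ℕ) : (1 : ℝ) ≤ (d : ℝ) ^ k :=
  one_le_pow₀ (by have := h.three_le; exact_mod_cast (by omega : 1 ≤ d))

lemma wordVal_nonneg {k : ℕ} (σ : Fin k → Fin (m + 1)) : 0 ≤ wordVal d σ :=
  Finset.sum_nonneg fun _ _ => by positivity

lemma wordVal_le_top {k : ℕ} (σ : Fin k → Fin (m + 1)) : wordVal d σ ≤ top d m k := by
  have h1 : ∑ i ∈ Finset.range k, (d : ℤ) ^ i = ∑ i : Fin k, (d : ℤ) ^ (k - 1 - (i : ℕ)) := by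
    rw [← Finset.sum_range_reflect, Finset.sum_range]
  rw [top, h1, Finset.mul_sum]
  unfold wordVal
  refine Finset.sum_le_sum fun i _ => ?_
  have : ((σ i : ℕ) : ℤ) ≤ m := by have := (σ i).2; omega
  exact mul_le_mul_of_nonneg_right this (by positivity)

/-! ### The mass of an integer -/

/-- The total weight of the words of length `k` with integer value `j`. -/
def mass (d : ℕ) {m : ℕ} (p : PMF (Fin (m + 1))) (k : ℕ) (j : ℤ) : ℝ :=
  ∑ σ : Fin k → Fin (m + 1) with wordVal d σ = j, wordWeight p σ

lemma eta_eq_mass (hd : d ≠ 0) {k : ℕ} (σ : Fin k → Fin (m + 1)) :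
    eta d p σ = mass d p k (wordVal d σ) := by
  unfold eta mass
  refine Finset.sum_congr ?_ fun _ _ => rfl
  ext σ'
  simp [projFin_eq_iff hd]

lemma mass_nonneg (k : ℕ) (j : ℤ) : 0 ≤ mass d p k j :=
  Finset.sum_nonneg fun _ _ => wordWeight_nonneg _

lemma mass_le_one (k : ℕ) (j : ℤ) : mass d p k j ≤ 1 := by
  rw [← sum_wordWeight (p := p) k]
  exact Finset.sum_le_sum_of_subset_of_nonneg (Finset.filter_subset _ _)
    fun _ _ _ => wordWeight_nonneg _

lemma mass_eq_zero_of_neg {k : ℕ} {j : ℤ} (hj : j < 0) : mass d p k j = 0 := by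
  unfold mass
  rw [Finset.filter_false_of_mem, Finset.sum_empty]
  intro σ _ hσ
  have := wordVal_nonneg (d := d) σ
  omega

lemma mass_eq_zero_of_gt {k : ℕ} {j : ℤ} (hj : top d m k < j) : mass d p k j = 0 := by
  unfold mass
  rw [Finset.filter_false_of_mem, Finset.sum_empty]
  intro σ _ hσ
  have := wordVal_le_top (d := d) σ
  omega

lemma mass_zero (j : ℤ) : mass d p 0 j = if j = 0 then 1 else 0 := by
  unfold mass
  rw [Finset.sum_filter]
  simp [wordVal, wordWeight, eq_comm]

lemma mass_one (j : ℤ) : mass d p 1 j = weightExt p j := by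
  unfold mass
  rw [Finset.sum_filter, ← (Equiv.funUnique (Fin 1) (Fin (m + 1))).symm.sum_comp]
  simp only [wordVal, wordWeight, Equiv.funUnique_symm_apply, Finset.univ_unique,
    Finset.sum_singleton, Finset.prod_singleton, uniqueElim_const]
  simp only [Fin.default_eq_zero, Fin.val_zero, tsub_self, pow_zero, mul_one]
  by_cases hj : 0 ≤ j ∧ j ≤ m
  · lift j to ℕ using hj.1
    rw [weightExt_natCast (by omega), Finset.sum_eq_single (⟨j, by omega⟩ : Fin (m + 1))]
    · simp
    · intro b _ hb
      rw [if_neg]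
      intro hbj
      apply hb
      ext
      exact_mod_cast hbj
    · simp
  · have h0 : weightExt p j = 0 := by
      unfold weightExt
      rw [dif_neg hj]
    rw [h0]
    refine Finset.sum_eq_zero fun i _ => ?_
    rw [if_neg]
    have := i.2
    omega

lemma mass_add_eq_sum (s k : ℕ) (j : ℤ) :
    mass d p (s + k) j =
      ∑ a : Fin s → Fin (m + 1), wordWeight p a * mass d p k (j - (d : ℤ) ^ k * wordVal d a) := by
  unfold mass
  rw [Finset.sum_filter, ← (Fin.appendEquiv s k).sum_comp, Fintype.sum_prod_type]
  refine Finset.sum_congr rfl fun a _ => ?_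
  rw [Finset.sum_filter, Finset.mul_sum]
  refine Finset.sum_congr rfl fun b _ => ?_
  change (if wordVal d (Fin.append a b) = j then wordWeight p (Fin.append a b) else 0) = _
  rw [wordVal_append, wordWeight_append]
  have : (d : ℤ) ^ k * wordVal d a + wordVal d b = j ↔
      wordVal d b = j - (d : ℤ) ^ k * wordVal d a := by
    constructor <;> intro h <;> linarith
  simp only [this]
  split_ifs <;> simp

lemma mass_mul (s : ℕ) (t : ℤ) (c : ℝ) :
    mass d p s t * c =
      ∑ a : Fin s → Fin (m + 1), if wordVal d a = t then wordWeight p a * c else 0 := by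
  rw [mass, Finset.sum_mul, Finset.sum_filter]

/-- The suffix value lies in [0, 2 d^k), so it must be y or y + d^k, and the prefix value t or t - 1
accordingly. -/
lemma mass_add (h : Admissible d m p) (s k : ℕ) (t : ℤ) {y : ℤ} (hy0 : 0 ≤ y)
    (hy : y < (d : ℤ) ^ k) :
    mass d p (s + k) ((d : ℤ) ^ k * t + y) =
      mass d p s t * mass d p k y + mass d p s (t - 1) * mass d p k (y + (d : ℤ) ^ k) := by
  rw [mass_add_eq_sum]
  have hpos := pow_pos_int h k
  have htop := top_lt h k
  rw [mass_mul, mass_mul, ← Finset.sum_add_distrib]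
  refine Finset.sum_congr rfl fun a _ => ?_
  rcases lt_trichotomy (wordVal d a) t with hlt | heq | hgt
  · rw [if_neg hlt.ne, zero_add]
    rcases eq_or_ne (wordVal d a) (t - 1) with heq | hne
    · rw [if_pos heq, heq]
      congr 2
      ring
    · rw [if_neg hne, mass_eq_zero_of_gt, mul_zero]
      have : wordVal d a ≤ t - 2 := by omega
      nlinarith
  · rw [if_pos heq, if_neg (by omega), heq, add_zero]
    congr 2
    ring
  · rw [if_neg hgt.ne', if_neg (by omega), mass_eq_zero_of_neg, mul_zero, add_zero]
    have : t + 1 ≤ wordVal d a := by omega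
    nlinarith

lemma mass_succ (h : Admissible d m p) (k : ℕ) (a : ℤ) {r : ℤ} (hr0 : 0 ≤ r) (hr : r < d) :
    mass d p (k + 1) (d * a + r) =
      mass d p k a * weightExt p r + mass d p k (a - 1) * weightExt p (r + d) := by
  have := mass_add h k 1 a hr0 (by simpa using hr)
  simpa only [pow_one, mass_one] using this

lemma exists_digit (h : Admissible d m p) (j : ℤ) : ∃ a r : ℤ, 0 ≤ r ∧ r < d ∧ j = d * a + r := by
  have := h.three_le
  exact ⟨j / d, j % d, Int.emod_nonneg _ (by omega), Int.emod_lt_of_pos _ (by omega),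
    (Int.mul_ediv_add_emod j d).symm⟩

/-- There are no gaps: the last digit can be taken to be the remainder r or, when the quotient
exceeds the previous maximum by one, r + d. Each digit weighs at least p_0. -/
lemma pow_le_mass (h : Admissible d m p) {k : ℕ} {j : ℤ} (h0 : 0 ≤ j) (hj : j ≤ top d m k) :
    weight p 0 ^ k ≤ mass d p k j := by
  have hp0 := weight_pos_zero h
  induction k generalizing j with
  | zero =>
    rw [top_zero] at hj
    obtain rfl : j = 0 := le_antisymm hj h0
    simp [mass_zero]
  | succ k ih =>
    obtain ⟨a, r, hr0, hr, rfl⟩ := exists_digit h j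
    have hm := h.lt
    have hle := h.le
    have hd0 : (0 : ℤ) < d := by have := h.three_le; omega
    rw [mass_succ h k a hr0 hr, pow_succ]
    rw [top_succ] at hj
    have ha0 : 0 ≤ a := by
      by_contra hneg
      have : a ≤ -1 := by omega
      nlinarith
    have hnn := mul_nonneg (mass_nonneg (d := d) (p := p) k a) (weightExt_nonneg (p := p) r)
    have hnn' := mul_nonneg (mass_nonneg (d := d) (p := p) k (a - 1))
      (weightExt_nonneg (p := p) (r + d))
    rcases le_or_gt a (top d m k) with ha | ha
    · have := mul_le_mul (ih ha0 ha) (weight_zero_le h hr0 (by omega)) hp0.le (mass_nonneg _ _)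
      linarith
    · have ha' : a = top d m k + 1 := by
        by_contra hne
        have : top d m k + 2 ≤ a := by omega
        nlinarith
      have hrd : r + d ≤ m := by
        subst ha'
        nlinarith
      have htn := top_nonneg (d := d) (m := m) k
      have := mul_le_mul (ih (j := a - 1) (by omega) (by omega))
        (weight_zero_le h (j := r + d) (by omega) hrd) hp0.le (mass_nonneg _ _)
      linarith

lemma mass_pos (h : Admissible d m p) {k : ℕ} {j : ℤ} (h0 : 0 ≤ j) (hj : j ≤ top d m k) :
    0 < mass d p k j :=
  (pow_pos (weight_pos_zero h) k).trans_le (pow_le_mass h h0 hj)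

/-- Only the zero word has value 0, so the lower bound `pow_le_mass` is attained at the left
endpoint. -/
lemma mass_first (h : Admissible d m p) (k : ℕ) : mass d p k 0 = weight p 0 ^ k := by
  induction k with
  | zero => simp [mass_zero]
  | succ k ih =>
    have := mass_succ h k 0 le_rfl (by have := h.three_le; omega)
    rw [mass_eq_zero_of_neg (k := k) (j := 0 - 1) (by omega)] at this
    simp only [mul_zero, add_zero, zero_mul] at this
    rw [this, ih, pow_succ]
    congr 1

/-! ### Neighbouring masses are comparable -/

/-- The constant comparing the masses of neighbouring integers at level `k`. -/
def ratioBound {m : ℕ} (p : PMF (Fin (m + 1))) (k : ℕ) : ℝ := ((k : ℝ) + 1) / weight p 0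

lemma ratioBound_succ (k : ℕ) : ratioBound p (k + 1) = ratioBound p k + 1 / weight p 0 := by
  unfold ratioBound
  push_cast
  ring

lemma one_le_ratioBound (h : Admissible d m p) (k : ℕ) : 1 ≤ ratioBound p k := by
  have hp0 := weight_pos_zero h
  have := weight_le_one (p := p) 0
  unfold ratioBound
  rw [one_le_div hp0]
  have : (0 : ℝ) ≤ k := k.cast_nonneg
  linarith

lemma inv_le_ratioBound (h : Admissible d m p) (k : ℕ) : 1 / weight p 0 ≤ ratioBound p k := by
  have hp0 := weight_pos_zero h
  unfold ratioBound
  have : (0 : ℝ) ≤ k := k.cast_nonneg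
  gcongr
  linarith

lemma weightExt_le_ratio (h : Admissible d m p) (k : ℕ) (i : ℤ) {j : ℤ} (h1 : 0 ≤ j)
    (h2 : j ≤ m) : weightExt p i ≤ ratioBound p k * weightExt p j := by
  have hp0 := weight_pos_zero h
  calc weightExt p i ≤ 1 := weightExt_le_one i
    _ = 1 / weight p 0 * weight p 0 := by field_simp
    _ ≤ ratioBound p k * weightExt p j :=
        mul_le_mul (inv_le_ratioBound h k) (weight_zero_le h h1 h2) hp0.le
          (zero_le_one.trans (one_le_ratioBound h k))

/-- Induction on k through `mass_succ`. As long as the same prefixes contribute, only digit weights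
change, at a cost of 1 / p_0. A term is passed on to a neighbouring prefix in two cases only, and
there the ordering of the weights (p_m ≤ p_(r+1), respectively p_0 ≤ p_(d-1)) lets the inductive
ratio be reused without a further factor. So each level adds 1 / p_0 to the bound instead of
multiplying it, and the bound stays linear in k. -/
lemma mass_neighbour (h : Admissible d m p) (k : ℕ) :
    ∀ j : ℤ, 0 ≤ j → j < top d m k →
      mass d p k j ≤ ratioBound p k * mass d p k (j + 1) ∧
      mass d p k (j + 1) ≤ ratioBound p k * mass d p k j := by
  have hp0 := weight_pos_zero h
  have h3 := h.three_le
  have hle := h.le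
  have hlt := h.lt
  have hd0 : (0 : ℤ) < d := by omega
  induction k with
  | zero =>
    intro j h0 hj
    rw [top_zero] at hj
    omega
  | succ k ih =>
    intro j h0 hj
    rw [top_succ] at hj
    obtain ⟨a, r, hr0, hr, rfl⟩ := exists_digit h j
    have ha0 : 0 ≤ a := by
      by_contra hneg
      have : a ≤ -1 := by omega
      nlinarith
    set D := ratioBound p (k + 1) with hD
    have hD1 : 1 ≤ D := one_le_ratioBound h _
    have hDk : D = ratioBound p k + 1 / weight p 0 := ratioBound_succ k
    have hDk0 : 0 ≤ ratioBound p k := zero_le_one.trans (one_le_ratioBound h _)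
    have hinv : 0 ≤ 1 / weight p 0 := by positivity
    have hA := mass_nonneg (d := d) (p := p) k a
    have hA' := mass_nonneg (d := d) (p := p) k (a - 1)
    rw [mass_succ h k a hr0 hr]
    rcases lt_or_ge (r + 1) d with hr1 | hr1
    · have hw1 : 0 ≤ weightExt p (r + 1) := weightExt_nonneg _
      rw [add_assoc, mass_succ h k a (r := r + 1) (by omega) hr1]
      constructor
      · rcases lt_trichotomy (r + d) m with hrd | hrd | hrd
        · have e1 := mul_le_mul_of_nonneg_left
            (weightExt_le_ratio h (k + 1) r (j := r + 1) (by omega) (by omega)) hA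
          have e2 := mul_le_mul_of_nonneg_left
            (weightExt_le_ratio h (k + 1) (r + d) (j := r + 1 + d) (by omega) (by omega)) hA'
          rw [← hD] at e1 e2
          linarith
        -- First critical case: the prefix a - 1 contributes to j through the digit m but not to j +
        -- 1, so its mass has to be absorbed by that of a.
        · rw [weightExt_of_gt (j := r + 1 + d) (by omega), hrd, mul_zero, add_zero]
          have haJ : a - 1 < top d m k := by
            by_contra hcon
            have : top d m k ≤ a - 1 := by omega
            nlinarith
          have hlast : weightExt p (m : ℤ) ≤ weightExt p (r + 1) := by
            have : weightExt p (m : ℤ) = weight p (Fin.last m) := weightExt_fin (Fin.last m)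
            rw [this]
            exact weight_last_le h (by omega) (by omega)
          have hwm := weightExt_nonneg (p := p) m
          have hnb : mass d p k (a - 1) ≤ ratioBound p k * mass d p k a := by
            rcases ha0.eq_or_lt with rfl | hapos
            · rw [mass_eq_zero_of_neg (by omega)]
              positivity
            · simpa using (ih (a - 1) (by omega) haJ).1
          have e1 : mass d p k a * weightExt p r ≤
              mass d p k a * (1 / weight p 0 * weightExt p (r + 1)) := by
            refine mul_le_mul_of_nonneg_left ?_ hA
            have := weight_zero_le h (j := r + 1) (by omega) (by omega)
            rw [one_div, ← div_eq_inv_mul, le_div_iff₀ hp0]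
            have := weightExt_le_one (p := p) r
            nlinarith
          have e2 : mass d p k (a - 1) * weightExt p m ≤
              ratioBound p k * mass d p k a * weightExt p (r + 1) :=
            mul_le_mul hnb hlast hwm (by positivity)
          rw [hDk]
          nlinarith
        · rw [weightExt_of_gt (j := r + 1 + d) (by omega), weightExt_of_gt (j := r + d) (by omega)]
          have e1 := mul_le_mul_of_nonneg_left
            (weightExt_le_ratio h (k + 1) r (j := r + 1) (by omega) (by omega)) hA
          rw [← hD] at e1
          linarith
      · have e1 := mul_le_mul_of_nonneg_left
          (weightExt_le_ratio h (k + 1) (r + 1) (j := r) (by omega) (by omega)) hA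
        have e2 : mass d p k (a - 1) * weightExt p (r + 1 + d) ≤
            mass d p k (a - 1) * (D * weightExt p (r + d)) := by
          refine mul_le_mul_of_nonneg_left ?_ hA'
          rcases le_or_gt (r + d) m with hrd | hrd
          · exact weightExt_le_ratio h (k + 1) _ (by omega) hrd
          · rw [weightExt_of_gt (j := r + 1 + d) (by omega)]
            exact mul_nonneg (by linarith) (weightExt_nonneg _)
        rw [← hD] at e1
        linarith
    -- Second critical case: passing to j + 1 changes the quotient, and the new prefix a + 1 enters
    -- with the digit 0.
    · obtain rfl : r = d - 1 := by omega
      have hj1 : (d : ℤ) * a + (d - 1) + 1 = d * (a + 1) + 0 := by ring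
      rw [hj1, mass_succ h k (a + 1) le_rfl hd0, weightExt_of_gt (j := (d : ℤ) - 1 + d) (by omega)]
      simp only [mul_zero, add_zero, zero_add, add_sub_cancel_right]
      have hB := mass_nonneg (d := d) (p := p) k (a + 1)
      have hwd : 0 ≤ weightExt p (d : ℤ) := weightExt_nonneg _
      constructor
      · have e1 := mul_le_mul_of_nonneg_left
          (weightExt_le_ratio h (k + 1) ((d : ℤ) - 1) (j := d) (by omega) (by omega)) hA
        have e2 : 0 ≤ D * (mass d p k (a + 1) * weightExt p 0) :=
          mul_nonneg (by linarith) (mul_nonneg hB (weightExt_nonneg _))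
        rw [← hD] at e1
        linarith
      · have hw : weightExt p 0 ≤ weightExt p ((d : ℤ) - 1) := by
          have : weightExt p 0 = weight p 0 := weightExt_fin (p := p) 0
          rw [this]
          exact weight_zero_le h (by omega) (by omega)
        have haJ : a ≤ top d m k := by
          by_contra hcon
          have : top d m k + 1 ≤ a := by omega
          nlinarith
        have hnb : mass d p k (a + 1) ≤ ratioBound p k * mass d p k a := by
          rcases haJ.eq_or_lt with heq | hlt'
          · rw [mass_eq_zero_of_gt (by omega)]
            positivity
          · exact (ih a ha0 hlt').2
        have e1 : mass d p k (a + 1) * weightExt p 0 ≤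
            ratioBound p k * mass d p k a * weightExt p ((d : ℤ) - 1) :=
          mul_le_mul hnb hw (weightExt_nonneg _) (by positivity)
        have e2 : mass d p k a * weightExt p (d : ℤ) ≤
            mass d p k a * (1 / weight p 0 * weightExt p ((d : ℤ) - 1)) := by
          refine mul_le_mul_of_nonneg_left ?_ hA
          have := weight_zero_le h (j := (d : ℤ) - 1) (by omega) (by omega)
          rw [one_div, ← div_eq_inv_mul, le_div_iff₀ hp0]
          have := weightExt_le_one (p := p) d
          nlinarith
        rw [hDk]
        nlinarith

lemma mass_le_of_dist (h : Admissible d m p) (k : ℕ) (n : ℕ) {i j : ℤ} (hj0 : 0 ≤ j)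
    (hj : j ≤ top d m k) (hij : |i - j| ≤ n) :
    mass d p k i ≤ ratioBound p k ^ n * mass d p k j := by
  have hD1 := one_le_ratioBound h k
  have hD0 : 0 ≤ ratioBound p k := by linarith
  induction n generalizing i with
  | zero =>
    have : i = j := by
      rw [Nat.cast_zero, abs_nonpos_iff] at hij
      omega
    simp [this]
  | succ n ih =>
    have hmono : ratioBound p k ^ n * mass d p k j ≤ ratioBound p k ^ (n + 1) * mass d p k j :=
      mul_le_mul_of_nonneg_right (pow_le_pow_right₀ hD1 n.le_succ) (mass_nonneg _ _)
    have hnn : 0 ≤ ratioBound p k ^ (n + 1) * mass d p k j := by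
      have := mass_nonneg (d := d) (p := p) k j
      positivity
    rcases lt_or_ge i 0 with hi0 | hi0
    · rwa [mass_eq_zero_of_neg hi0]
    rcases lt_or_ge (top d m k) i with hi | hi
    · rwa [mass_eq_zero_of_gt hi]
    push_cast at hij
    rw [abs_le] at hij
    rcases lt_trichotomy i j with hlt | heq | hgt
    · have h1 := (mass_neighbour h k i hi0 (by omega)).1
      have h2 := ih (i := i + 1) (by rw [abs_le]; omega)
      calc _ ≤ _ := h1
        _ ≤ ratioBound p k * (ratioBound p k ^ n * mass d p k j) :=
            mul_le_mul_of_nonneg_left h2 hD0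
        _ = _ := by ring
    · subst heq
      exact (ih (by simp)).trans hmono
    · have h1 := (mass_neighbour h k (i - 1) (by omega) (by omega)).2
      have h2 := ih (i := i - 1) (by rw [abs_le]; omega)
      rw [sub_add_cancel] at h1
      calc _ ≤ _ := h1
        _ ≤ ratioBound p k * (ratioBound p k ^ n * mass d p k j) :=
            mul_le_mul_of_nonneg_left h2 hD0
        _ = _ := by ring

/-! ### Elementary inequalities -/

lemma sum_le_sum_of_injOn {α β : Type*} [DecidableEq β] {S : Finset α} {T : Finset β}
    (e : α → β) (f : α → ℝ) (g : β → ℝ) (hmaps : ∀ a ∈ S, e a ∈ T) (hinj : Set.InjOn e S)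
    (hfg : ∀ a ∈ S, f a ≤ g (e a)) (hg : ∀ b ∈ T, 0 ≤ g b) : ∑ a ∈ S, f a ≤ ∑ b ∈ T, g b :=
  calc ∑ a ∈ S, f a ≤ ∑ a ∈ S, g (e a) := Finset.sum_le_sum hfg
    _ = ∑ b ∈ S.image e, g b := (Finset.sum_image hinj).symm
    _ ≤ ∑ b ∈ T, g b := Finset.sum_le_sum_of_subset_of_nonneg
        (Finset.image_subset_iff.2 hmaps) fun b hb _ => hg b hb

/-- Cut the integers into blocks of length M: `T` indexes the blocks that meet `S`, and each costs
at most one complete sum over residues. -/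
lemma sum_le_card_mul_sum_block {S T : Finset ℤ} {M : ℤ} (hM : 0 < M) (f g : ℤ → ℝ)
    (hT : ∀ j ∈ S, j / M ∈ T) (hfg : ∀ j ∈ S, f j ≤ g (j % M))
    (hg : ∀ y ∈ Finset.Ico 0 M, 0 ≤ g y) :
    ∑ j ∈ S, f j ≤ T.card * ∑ y ∈ Finset.Ico 0 M, g y := by
  have h1 : ∑ j ∈ S, f j ≤ ∑ b ∈ T ×ˢ Finset.Ico 0 M, g b.2 := by
    refine sum_le_sum_of_injOn (fun j => (j / M, j % M)) f (fun b => g b.2) ?_ ?_ hfg ?_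
    · intro j hj
      rw [Finset.mem_product]
      exact ⟨hT j hj, Finset.mem_Ico.2 ⟨Int.emod_nonneg _ hM.ne', Int.emod_lt_of_pos _ hM⟩⟩
    · intro i _ j _ hij
      simp only [Prod.mk.injEq] at hij
      rw [← Int.mul_ediv_add_emod i M, ← Int.mul_ediv_add_emod j M, hij.1, hij.2]
    · intro b hb
      exact hg _ (Finset.mem_product.1 hb).2
  rw [Finset.sum_product] at h1
  simpa using h1

lemma rpow_le_of_comparable {a b E : ℝ} (q : ℝ) (ha : 0 < a) (hb : 0 < b) (hE : 1 ≤ E)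
    (hab : a ≤ E * b) (hba : b ≤ E * a) : a ^ q ≤ E ^ |q| * b ^ q := by
  have hE0 : 0 < E := by linarith
  rcases le_total 0 q with hq | hq
  · rw [abs_of_nonneg hq, ← Real.mul_rpow hE0.le hb.le]
    exact Real.rpow_le_rpow ha.le hab hq
  · rw [abs_of_nonpos hq, Real.rpow_neg hE0.le, ← Real.inv_rpow hE0.le,
      ← Real.mul_rpow (inv_nonneg.2 hE0.le) hb.le]
    refine Real.rpow_le_rpow_of_nonpos (by positivity) ?_ hq
    rw [← div_eq_inv_mul, div_le_iff₀ hE0]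
    linarith

lemma one_le_rpow_abs {E : ℝ} (hE : 1 ≤ E) (q : ℝ) : 1 ≤ E ^ |q| :=
  Real.one_le_rpow hE (abs_nonneg q)

/-! ### Power sums of masses -/

/-- The mass of the integers congruent to `y` modulo `d ^ n`, for `0 ≤ y < d ^ n`. -/
def foldMass (d : ℕ) {m : ℕ} (p : PMF (Fin (m + 1))) (n : ℕ) (y : ℤ) : ℝ :=
  mass d p n y + mass d p n (y + (d : ℤ) ^ n)

/-- The sum of the `q`-th powers of the masses of the residue classes modulo `d ^ n`. -/
def foldSum (d : ℕ) {m : ℕ} (p : PMF (Fin (m + 1))) (n : ℕ) (q : ℝ) : ℝ :=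
  ∑ y ∈ Finset.Ico (0 : ℤ) ((d : ℤ) ^ n), foldMass d p n y ^ q

/-- The integers `j` such that `[j, j + ξ] / d ^ k` is contained in `[u, v]`. -/
def window (d m : ℕ) (u v : ℝ) (k : ℕ) : Finset ℤ :=
  Finset.Icc ⌈u * (d : ℝ) ^ k⌉ ⌊v * (d : ℝ) ^ k - xi d m⌋

/-- The sum of the `q`-th powers of the masses over a window. -/
def windowSum (d : ℕ) {m : ℕ} (p : PMF (Fin (m + 1))) (u v : ℝ) (k : ℕ) (q : ℝ) : ℝ :=
  ∑ j ∈ window d m u v k, mass d p k j ^ q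

lemma mem_window {u v : ℝ} {k : ℕ} {j : ℤ} :
    j ∈ window d m u v k ↔ u * (d : ℝ) ^ k ≤ j ∧ j + xi d m ≤ v * (d : ℝ) ^ k := by
  rw [window, Finset.mem_Icc, Int.ceil_le, Int.le_floor, le_sub_iff_add_le]

lemma window_bounds (h : Admissible d m p) {u v : ℝ} (hu : 0 ≤ u) (hv : v ≤ xi d m) {k : ℕ}
    {j : ℤ} (hj : j ∈ window d m u v k) : 0 ≤ j ∧ j ≤ top d m k := by
  obtain ⟨h1, h2⟩ := mem_window.1 hj
  have hd := one_le_pow_real h k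
  constructor
  · have : (0 : ℝ) ≤ j := le_trans (by positivity) h1
    exact_mod_cast this
  · have : (j : ℝ) ≤ top d m k := by
      rw [top_eq_xi h.three_le]
      nlinarith
    exact_mod_cast this

lemma window_full (h : Admissible d m p) (k : ℕ) :
    window d m 0 (xi d m) k = Finset.Icc 0 (top d m k) := by
  ext j
  rw [mem_window, Finset.mem_Icc, ← Int.cast_le (R := ℝ) (m := j), top_eq_xi h.three_le,
    zero_mul, Int.cast_nonneg_iff]
  constructor <;> rintro ⟨h1, h2⟩ <;> exact ⟨h1, by linarith⟩

lemma mass_rpow_nonneg (k : ℕ) (j : ℤ) (q : ℝ) : 0 ≤ mass d p k j ^ q :=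
  Real.rpow_nonneg (mass_nonneg _ _) _

lemma foldMass_nonneg (n : ℕ) (y : ℤ) : 0 ≤ foldMass d p n y :=
  add_nonneg (mass_nonneg _ _) (mass_nonneg _ _)

lemma foldMass_rpow_nonneg (n : ℕ) (y : ℤ) (q : ℝ) : 0 ≤ foldMass d p n y ^ q :=
  Real.rpow_nonneg (foldMass_nonneg _ _) _

lemma pow_le_foldMass (h : Admissible d m p) {n : ℕ} {y : ℤ} (h0 : 0 ≤ y)
    (hy : y < (d : ℤ) ^ n) : weight p 0 ^ n ≤ foldMass d p n y := by
  have := pow_le_top_add_one h n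
  exact (pow_le_mass h h0 (by omega)).trans (le_add_of_nonneg_right (mass_nonneg _ _))

lemma foldMass_pos (h : Admissible d m p) {n : ℕ} {y : ℤ} (h0 : 0 ≤ y)
    (hy : y < (d : ℤ) ^ n) : 0 < foldMass d p n y :=
  (pow_pos (weight_pos_zero h) n).trans_le (pow_le_foldMass h h0 hy)

lemma foldMass_le_two (n : ℕ) (y : ℤ) : foldMass d p n y ≤ 2 := by
  have h1 := mass_le_one (d := d) (p := p) n y
  have h2 := mass_le_one (d := d) (p := p) n (y + (d : ℤ) ^ n)
  unfold foldMass
  linarith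

lemma foldSum_pos (h : Admissible d m p) (n : ℕ) (q : ℝ) : 0 < foldSum d p n q := by
  refine Finset.sum_pos (fun y hy => ?_) ⟨0, Finset.mem_Ico.2 ⟨le_rfl, pow_pos_int h n⟩⟩
  obtain ⟨h1, h2⟩ := Finset.mem_Ico.1 hy
  exact Real.rpow_pos_of_pos (foldMass_pos h h1 h2) _

/-! ### Interior blocks -/

/-- Both coefficients in `mass_add` lie in [p_0^s, 1] when t and t - 1 are in range. The constant
does not depend on n, so every interior block looks the same. -/
lemma mass_block_comparable (h : Admissible d m p) {s n : ℕ} {t y : ℤ} (ht1 : 1 ≤ t)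
    (ht : t ≤ top d m s) (hy0 : 0 ≤ y) (hy : y < (d : ℤ) ^ n) :
    mass d p (s + n) ((d : ℤ) ^ n * t + y) ≤ foldMass d p n y ∧
    foldMass d p n y ≤ (weight p 0 ^ s)⁻¹ * mass d p (s + n) ((d : ℤ) ^ n * t + y) := by
  have hp := pow_pos (weight_pos_zero h) s
  have a1 := pow_le_mass h (by omega : 0 ≤ t) ht
  have a2 := pow_le_mass h (k := s) (by omega : 0 ≤ t - 1) (by omega)
  have b1 := mass_le_one (d := d) (p := p) s t
  have b2 := mass_le_one (d := d) (p := p) s (t - 1)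
  have c1 := mass_nonneg (d := d) (p := p) n y
  have c2 := mass_nonneg (d := d) (p := p) n (y + (d : ℤ) ^ n)
  rw [mass_add h s n t hy0 hy]
  unfold foldMass
  constructor
  · nlinarith
  · rw [← div_eq_inv_mul, le_div_iff₀ hp]
    nlinarith

lemma mass_block_pos (h : Admissible d m p) {s n : ℕ} {t y : ℤ} (ht1 : 1 ≤ t)
    (ht : t ≤ top d m s) (hy0 : 0 ≤ y) (hy : y < (d : ℤ) ^ n) :
    0 < mass d p (s + n) ((d : ℤ) ^ n * t + y) := by
  have h1 := (mass_block_comparable h ht1 ht hy0 hy).2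
  have h2 := foldMass_pos h hy0 hy
  have hp := pow_pos (weight_pos_zero h) s
  exact pos_of_mul_pos_right (h2.trans_le h1) (inv_nonneg.2 hp.le)

/-- The constant comparing powers of masses and of folded masses. -/
def blockConst {m : ℕ} (p : PMF (Fin (m + 1))) (s : ℕ) (q : ℝ) : ℝ :=
  ((weight p 0 ^ s)⁻¹) ^ |q|

lemma one_le_blockConst (h : Admissible d m p) (s : ℕ) (q : ℝ) : 1 ≤ blockConst p s q :=
  one_le_rpow_abs ((one_le_inv₀ (pow_pos (weight_pos_zero h) s)).2
    (pow_le_one₀ (weight_nonneg 0) (weight_le_one 0))) q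

lemma mass_block_rpow_comparable (h : Admissible d m p) (q : ℝ) {s n : ℕ} {t y : ℤ}
    (ht1 : 1 ≤ t) (ht : t ≤ top d m s) (hy0 : 0 ≤ y) (hy : y < (d : ℤ) ^ n) :
    mass d p (s + n) ((d : ℤ) ^ n * t + y) ^ q ≤ blockConst p s q * foldMass d p n y ^ q ∧
    foldMass d p n y ^ q ≤ blockConst p s q * mass d p (s + n) ((d : ℤ) ^ n * t + y) ^ q := by
  obtain ⟨h1, h2⟩ := mass_block_comparable h ht1 ht hy0 hy
  have hE : 1 ≤ (weight p 0 ^ s)⁻¹ := (one_le_inv₀ (pow_pos (weight_pos_zero h) s)).2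
    (pow_le_one₀ (weight_nonneg 0) (weight_le_one 0))
  have hpos := mass_block_pos h ht1 ht hy0 hy
  have hpos' := foldMass_pos h hy0 hy
  have h3 : mass d p (s + n) ((d : ℤ) ^ n * t + y) ≤ (weight p 0 ^ s)⁻¹ * foldMass d p n y :=
    h1.trans (le_mul_of_one_le_left hpos'.le hE)
  exact ⟨rpow_le_of_comparable q hpos hpos' hE h3 h2, rpow_le_of_comparable q hpos' hpos hE h2 h3⟩

/-- At a fixed depth s the window is covered by finitely many interior blocks and contains a whole
one. -/
lemma windowSum_comparable (h : Admissible d m p) {u v : ℝ} (hu : 0 < u) (huv : u < v)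
    (hv : v < xi d m) (q : ℝ) : ∃ s : ℕ, ∃ C : ℝ, 0 < C ∧ ∀ n : ℕ,
      windowSum d p u v (s + n) q ≤ C * foldSum d p n q ∧
      foldSum d p n q ≤ C * windowSum d p u v (s + n) q := by
  have hxi := xi_bounds h
  have hd1 : (1 : ℝ) < d := by have := h.three_le; exact_mod_cast (by omega : 1 < d)
  set c := min u (min (xi d m - v) (v - u)) with hc
  have hc0 : 0 < c := lt_min hu (lt_min (by linarith) (by linarith))
  -- This leaves more than three blocks of length d^(-s) between u and v and on either side of [u,
  -- v] within [0, ξ]: room for rounding up to a block, for the block itself, and for the overhang ξ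
  -- < 2.
  obtain ⟨s, hs⟩ := pow_unbounded_of_one_lt (3 / c) hd1
  rw [div_lt_iff₀ hc0] at hs
  have hds := one_le_pow_real h s
  have hs1 : 3 < u * (d : ℝ) ^ s := by
    have : c ≤ u := min_le_left _ _
    nlinarith
  have hs2 : 3 < (xi d m - v) * (d : ℝ) ^ s := by
    have : c ≤ xi d m - v := (min_le_right _ _).trans (min_le_left _ _)
    nlinarith
  have hs3 : 3 < (v - u) * (d : ℝ) ^ s := by
    have : c ≤ v - u := (min_le_right _ _).trans (min_le_right _ _)
    nlinarith
  have hB := one_le_blockConst h s q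
  have hcard : (0 : ℝ) ≤ ((Finset.Icc 1 (top d m s)).card : ℝ) := Nat.cast_nonneg _
  refine ⟨s, ((Finset.Icc 1 (top d m s)).card + 1) * blockConst p s q, by positivity,
    fun n => ⟨?_, ?_⟩⟩
  · have hM := pow_pos_int h n
    have hn := one_le_pow_real h n
    have hmem : ∀ j ∈ window d m u v (s + n), j / (d : ℤ) ^ n ∈ Finset.Icc 1 (top d m s) := by
      intro j hj
      obtain ⟨h1, h2⟩ := mem_window.1 hj
      rw [pow_add] at h1 h2
      have hlo : (1 : ℤ) * (d : ℤ) ^ n ≤ j := by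
        have : (1 : ℝ) * (d : ℝ) ^ n ≤ j := by nlinarith
        exact_mod_cast this
      have hhi : j < (top d m s + 1) * (d : ℤ) ^ n := by
        have : (j : ℝ) < (top d m s + 1) * (d : ℝ) ^ n := by
          rw [top_eq_xi h.three_le]
          nlinarith
        exact_mod_cast this
      rw [Finset.mem_Icc]
      exact ⟨Int.le_ediv_of_mul_le hM hlo, Int.lt_add_one_iff.1 (Int.ediv_lt_of_lt_mul hM hhi)⟩
    have key := sum_le_card_mul_sum_block hM (fun j => mass d p (s + n) j ^ q)
      (fun y => blockConst p s q * foldMass d p n y ^ q) hmem ?_ ?_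
    · rw [← Finset.mul_sum] at key
      change windowSum d p u v (s + n) q ≤ _ * (_ * foldSum d p n q) at key
      have := foldSum_pos h n q
      have h1 : 0 ≤ blockConst p s q * foldSum d p n q := by positivity
      linarith
    · intro j hj
      have := Finset.mem_Icc.1 (hmem j hj)
      have key := (mass_block_rpow_comparable h q this.1 this.2 (Int.emod_nonneg j hM.ne')
        (Int.emod_lt_of_pos j hM)).1
      rwa [Int.mul_ediv_add_emod] at key
    · intro y _
      exact mul_nonneg (by linarith) (foldMass_rpow_nonneg _ _ _)
  · have hM := pow_pos_int h n
    have hn := one_le_pow_real h n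
    set t := ⌈u * (d : ℝ) ^ s⌉ with ht
    have ht1 : u * (d : ℝ) ^ s ≤ t := Int.le_ceil _
    have ht2 : (t : ℝ) < u * (d : ℝ) ^ s + 1 := Int.ceil_lt_add_one _
    have ht3 : 1 ≤ t := by
      have : (1 : ℝ) ≤ t := by linarith
      exact_mod_cast this
    have ht4 : t ≤ top d m s := by
      have : (t : ℝ) ≤ top d m s := by
        rw [top_eq_xi h.three_le]
        nlinarith
      exact_mod_cast this
    have hle : foldSum d p n q ≤ blockConst p s q * windowSum d p u v (s + n) q := by
      unfold foldSum windowSum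
      rw [Finset.mul_sum]
      refine sum_le_sum_of_injOn (fun y => (d : ℤ) ^ n * t + y) _ _ ?_ ?_ ?_ ?_
      · intro y hy
        obtain ⟨hy0, hy1⟩ := Finset.mem_Ico.1 hy
        have hy0' : (0 : ℝ) ≤ y := by exact_mod_cast hy0
        have hy1' : (y : ℝ) + 1 ≤ (d : ℝ) ^ n := by exact_mod_cast hy1
        rw [mem_window, pow_add]
        push_cast
        constructor <;> nlinarith
      · intro a _ b _ hab
        simpa using hab
      · intro y hy
        obtain ⟨hy0, hy1⟩ := Finset.mem_Ico.1 hy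
        exact (mass_block_rpow_comparable h q ht3 ht4 hy0 hy1).2
      · intro j _
        exact mul_nonneg (by linarith) (mass_rpow_nonneg _ _ _)
    refine hle.trans ?_
    have : 0 ≤ windowSum d p u v (s + n) q := Finset.sum_nonneg fun _ _ => mass_rpow_nonneg _ _ _
    have h2 : 0 ≤ blockConst p s q * windowSum d p u v (s + n) q := by positivity
    nlinarith

/-! ### Supermultiplicativity -/

/-- The purpose of the barrier: u > ξ - 1 puts j + d^k beyond the largest value of level k, so the
carry term of `mass_add` vanishes. -/
lemma mass_mul_mass (h : Admissible d m p) {u v : ℝ} (hu : xi d m - 1 < u) (hv : v < 1)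
    {s k : ℕ} (i : ℤ) {j : ℤ} (hj : j ∈ window d m u v k) :
    0 ≤ j ∧ j < (d : ℤ) ^ k ∧
      mass d p (s + k) ((d : ℤ) ^ k * i + j) = mass d p s i * mass d p k j := by
  have hxi := xi_bounds h
  obtain ⟨h1, h2⟩ := mem_window.1 hj
  have hk := one_le_pow_real h k
  have hj0 : 0 ≤ j := by
    have : (0 : ℝ) ≤ j := by nlinarith
    exact_mod_cast this
  have hj1 : j < (d : ℤ) ^ k := by
    have : (j : ℝ) < (d : ℝ) ^ k := by nlinarith
    exact_mod_cast this
  refine ⟨hj0, hj1, ?_⟩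
  rw [mass_add h s k i hj0 hj1, mass_eq_zero_of_gt (j := j + (d : ℤ) ^ k), mul_zero, add_zero]
  have : (top d m k : ℝ) < j + (d : ℝ) ^ k := by
    rw [top_eq_xi h.three_le]
    nlinarith
  exact_mod_cast this

/-- The map (i, j) ↦ d^k i + j is injective because 0 ≤ j < d^k, and it stays in the window because
v < 1 < ξ. Masses multiply exactly, so the sign of q is irrelevant. -/
lemma windowSum_mul_le (h : Admissible d m p) {u v : ℝ} (hu : xi d m - 1 < u) (hv : v < 1)
    (q : ℝ) (s k : ℕ) :
    windowSum d p u v s q * windowSum d p u v k q ≤ windowSum d p u v (s + k) q := by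
  have hxi := xi_bounds h
  unfold windowSum
  rw [Finset.sum_mul_sum, ← Finset.sum_product']
  refine sum_le_sum_of_injOn (fun x : ℤ × ℤ => (d : ℤ) ^ k * x.1 + x.2) _ _ ?_ ?_ ?_ ?_
  · rintro ⟨i, j⟩ hij
    obtain ⟨hi, hj⟩ := Finset.mem_product.1 hij
    obtain ⟨h1, h2⟩ := mem_window.1 hi
    obtain ⟨h3, h4⟩ := mem_window.1 hj
    have hk := one_le_pow_real h k
    have hs := one_le_pow_real h s
    rw [mem_window, pow_add]
    push_cast
    simp only at h1 h2 h3 h4 ⊢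
    constructor <;> nlinarith
  · rintro ⟨i, j⟩ hij ⟨i', j'⟩ hij' heq
    have hij := (Finset.mem_product.1 hij).2
    have hij' := (Finset.mem_product.1 hij').2
    obtain ⟨a1, a2, -⟩ := mass_mul_mass h hu hv (s := s) i hij
    obtain ⟨b1, b2, -⟩ := mass_mul_mass h hu hv (s := s) i' hij'
    simp only at heq a1 a2 b1 b2
    have hM := pow_pos_int h k
    have e1 : i = i' := by
      have x1 := congrArg (· / (d : ℤ) ^ k) heq
      simpa [Int.mul_add_ediv_left _ _ hM.ne', Int.ediv_eq_zero_of_lt a1 a2,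
        Int.ediv_eq_zero_of_lt b1 b2] using x1
    subst e1
    simpa using heq
  · rintro ⟨i, j⟩ hij
    have hj := (Finset.mem_product.1 hij).2
    simp only at hj ⊢
    rw [(mass_mul_mass h hu hv (s := s) i hj).2.2, Real.mul_rpow (mass_nonneg _ _) (mass_nonneg _ _)]
  · intro j _
    exact mass_rpow_nonneg _ _ _

lemma windowSum_pos (h : Admissible d m p) {u v : ℝ} (hu : 0 ≤ u) (hv : v ≤ xi d m) {k : ℕ}
    (hne : (window d m u v k).Nonempty) (q : ℝ) : 0 < windowSum d p u v k q := by
  refine Finset.sum_pos (fun j hj => ?_) hne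
  obtain ⟨h1, h2⟩ := window_bounds h hu hv hj
  exact Real.rpow_pos_of_pos (mass_pos h h1 h2) _

lemma windowSum_le (h : Admissible d m p) {u v : ℝ} (hu : 0 ≤ u) (hv : v ≤ xi d m) (k : ℕ)
    (q : ℝ) : windowSum d p u v k q ≤ 2 * (d : ℝ) ^ k * ((weight p 0)⁻¹ ^ |q|) ^ k := by
  have hp0 := weight_pos_zero h
  have hsub : window d m u v k ⊆ Finset.Ico 0 (2 * (d : ℤ) ^ k) := by
    intro j hj
    obtain ⟨h1, h2⟩ := window_bounds h hu hv hj
    have := top_lt h k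
    exact Finset.mem_Ico.2 ⟨h1, by omega⟩
  have hterm : ∀ j ∈ window d m u v k, mass d p k j ^ q ≤ ((weight p 0)⁻¹ ^ |q|) ^ k := by
    intro j hj
    obtain ⟨h1, h2⟩ := window_bounds h hu hv hj
    have hE : 1 ≤ (weight p 0)⁻¹ ^ k :=
      one_le_pow₀ ((one_le_inv₀ hp0).2 (weight_le_one 0))
    have := rpow_le_of_comparable q (mass_pos h h1 h2) one_pos hE ?_ ?_
    · rwa [Real.one_rpow, mul_one, ← Real.rpow_pow_comm (by positivity)] at this
    · exact (mass_le_one _ _).trans (by simpa using hE)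
    · rw [inv_pow, ← div_eq_inv_mul, le_div_iff₀ (pow_pos hp0 k), one_mul]
      exact pow_le_mass h h1 h2
  calc windowSum d p u v k q ≤ ∑ _j ∈ window d m u v k, ((weight p 0)⁻¹ ^ |q|) ^ k :=
        Finset.sum_le_sum hterm
    _ ≤ ∑ _j ∈ Finset.Ico 0 (2 * (d : ℤ) ^ k), ((weight p 0)⁻¹ ^ |q|) ^ k :=
        Finset.sum_le_sum_of_subset_of_nonneg hsub fun _ _ _ => by positivity
    _ = 2 * (d : ℝ) ^ k * ((weight p 0)⁻¹ ^ |q|) ^ k := by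
        rw [Finset.sum_const, Int.card_Ico, sub_zero, nsmul_eq_mul]
        congr 1
        have : ((2 * (d : ℤ) ^ k).toNat : ℤ) = 2 * (d : ℤ) ^ k := Int.toNat_of_nonneg (by positivity)
        exact_mod_cast this

/-! ### The sum over all integers -/

/-- The sum of the `q`-th powers of all the nonzero masses of level `k`. -/
def fullSum (d : ℕ) {m : ℕ} (p : PMF (Fin (m + 1))) (k : ℕ) (q : ℝ) : ℝ :=
  ∑ j ∈ Finset.Icc 0 (top d m k), mass d p k j ^ q

lemma pow_le_fullSum (h : Admissible d m p) (k : ℕ) (q : ℝ) :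
    (weight p 0 ^ q) ^ k ≤ fullSum d p k q := by
  have h0 : (weight p 0 ^ q) ^ k = mass d p k 0 ^ q := by
    rw [mass_first h, Real.rpow_pow_comm (weight_nonneg 0)]
  rw [h0]
  exact Finset.single_le_sum (f := fun j => mass d p k j ^ q)
    (fun j _ => mass_rpow_nonneg k j q) (Finset.mem_Icc.2 ⟨le_rfl, top_nonneg k⟩)

lemma fullSum_pos (h : Admissible d m p) (k : ℕ) (q : ℝ) : 0 < fullSum d p k q :=
  (pow_pos (Real.rpow_pos_of_pos (weight_pos_zero h) q) k).trans_le (pow_le_fullSum h k q)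

lemma top_one : top d m 1 = m := by simp [top]

lemma foldSum_le_fullSum (h : Admissible d m p) (k : ℕ) (q : ℝ) :
    foldSum d p k q ≤ blockConst p 1 q * fullSum d p (k + 1) q := by
  have hB := one_le_blockConst h 1 q
  have hle := h.le
  have h3 := h.three_le
  unfold foldSum fullSum
  rw [Finset.mul_sum]
  refine sum_le_sum_of_injOn (fun y => (d : ℤ) ^ k * 1 + y) _ _ ?_ ?_ ?_ ?_
  · intro y hy
    obtain ⟨hy0, hy1⟩ := Finset.mem_Ico.1 hy
    have hk := pow_pos_int h k
    have := top_nonneg (d := d) (m := m) k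
    have hm : (2 : ℤ) ≤ m := by omega
    rw [Finset.mem_Icc, top_succ']
    constructor <;> nlinarith
  · intro a _ b _ hab
    simpa using hab
  · intro y hy
    obtain ⟨hy0, hy1⟩ := Finset.mem_Ico.1 hy
    rw [add_comm k 1]
    exact (mass_block_rpow_comparable h q le_rfl (by rw [top_one]; omega) hy0 hy1).2
  · intro j _
    exact mul_nonneg (by linarith) (mass_rpow_nonneg _ _ _)

lemma mass_succ_first_block (h : Admissible d m p) (k : ℕ) {y : ℤ} (hy0 : 0 ≤ y)
    (hy : y < (d : ℤ) ^ k) : mass d p (k + 1) y = weight p 0 * mass d p k y := by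
  have := mass_add h 1 k 0 hy0 hy
  rw [mul_zero, zero_add, mass_eq_zero_of_neg (k := 1) (j := 0 - 1) (by omega), zero_mul, add_zero,
    mass_one, add_comm 1 k] at this
  exact this

/-- A first digit at most m - 1 only reaches values below d^k (m - 1) + 2 d^k, so the first digit
must be m. -/
lemma mass_succ_last_block (h : Admissible d m p) (k : ℕ) {j : ℤ}
    (hj0 : (d : ℤ) ^ k * (m + 1) ≤ j) (hj : j ≤ top d m (k + 1)) :
    mass d p (k + 1) j = weight p (Fin.last m) * mass d p k (j - (d : ℤ) ^ k * m) := by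
  have htop := top_lt h k
  rw [top_succ'] at hj
  have := mass_add h 1 k (m + 1) (y := j - (d : ℤ) ^ k * (m + 1)) (by omega) (by nlinarith)
  rw [mass_eq_zero_of_gt (k := 1) (j := (m : ℤ) + 1) (by rw [top_one]; omega), zero_mul, zero_add,
    mass_one, add_comm 1 k, add_sub_cancel, add_sub_cancel_right] at this
  rw [this]
  congr 2
  · exact weightExt_fin (Fin.last m)
  · ring

/-- The blocks 1, …, m are interior and are controlled by `foldSum`. The two end blocks force the
first digit to be 0 or m and are scaled pieces of the previous level. -/
lemma fullSum_succ_le (h : Admissible d m p) (k : ℕ) (q : ℝ) :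
    fullSum d p (k + 1) q ≤ m * blockConst p 1 q * foldSum d p k q +
      max (weight p 0 ^ q) (weight p (Fin.last m) ^ q) * fullSum d p k q := by
  have hM := pow_pos_int h k
  have hB := one_le_blockConst h 1 q
  have htop := top_lt h k
  have htop' := pow_le_top_add_one h k
  have hts := top_succ' (d := d) (m := m) k
  unfold fullSum
  rw [← Finset.sum_filter_add_sum_filter_not (Finset.Icc 0 (top d m (k + 1)))
    (fun j => (d : ℤ) ^ k ≤ j ∧ j < (d : ℤ) ^ k * (m + 1))]
  refine add_le_add ?_ ?_
  · have hmem : ∀ j ∈ (Finset.Icc 0 (top d m (k + 1))).filter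
        (fun j => (d : ℤ) ^ k ≤ j ∧ j < (d : ℤ) ^ k * (m + 1)),
        j / (d : ℤ) ^ k ∈ Finset.Icc (1 : ℤ) m := by
      intro j hj
      obtain ⟨-, h1, h2⟩ := Finset.mem_filter.1 hj
      rw [Finset.mem_Icc]
      exact ⟨Int.le_ediv_of_mul_le hM (by linarith),
        Int.lt_add_one_iff.1 (Int.ediv_lt_of_lt_mul hM (by linarith))⟩
    have key := sum_le_card_mul_sum_block hM (fun j => mass d p (k + 1) j ^ q)
      (fun y => blockConst p 1 q * foldMass d p k y ^ q) hmem ?_ ?_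
    · rw [← Finset.mul_sum, Int.card_Icc] at key
      simpa [mul_assoc, foldSum] using key
    · intro j hj
      have := Finset.mem_Icc.1 (hmem j hj)
      have key := (mass_block_rpow_comparable h q (s := 1) this.1 (by rw [top_one]; exact this.2)
        (Int.emod_nonneg j hM.ne') (Int.emod_lt_of_pos j hM)).1
      rwa [Int.mul_ediv_add_emod, add_comm 1 k] at key
    · intro y _
      exact mul_nonneg (by linarith) (foldMass_rpow_nonneg _ _ _)
  · rw [Finset.mul_sum]
    have hcases : ∀ j ∈ (Finset.Icc 0 (top d m (k + 1))).filter
        (fun j => ¬ ((d : ℤ) ^ k ≤ j ∧ j < (d : ℤ) ^ k * (m + 1))),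
        0 ≤ j ∧ j ≤ top d m (k + 1) ∧ (j < (d : ℤ) ^ k ∨ (d : ℤ) ^ k * (m + 1) ≤ j) := by
      intro j hj
      obtain ⟨h1, h2⟩ := Finset.mem_filter.1 hj
      obtain ⟨h3, h4⟩ := Finset.mem_Icc.1 h1
      refine ⟨h3, h4, ?_⟩
      by_contra hcon
      push Not at hcon
      exact h2 hcon
    have hm0 : (0 : ℤ) ≤ m := by positivity
    -- The first end block lands below d^k and the last one at or above it. Together they use each
    -- integer of level k at most once, which gives the maximum of the two factors rather than their
    -- sum.
    refine sum_le_sum_of_injOn (fun j => if j < (d : ℤ) ^ k then j else j - (d : ℤ) ^ k * m)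
      _ _ ?_ ?_ ?_ ?_
    · intro j hj
      obtain ⟨h1, h2, h3⟩ := hcases j hj
      rw [Finset.mem_Icc]
      split_ifs with hlt
      · constructor <;> linarith
      · have := h3.resolve_left hlt
        constructor <;> nlinarith
    · intro i hi j hj hij
      obtain ⟨a1, a2, a3⟩ := hcases i hi
      obtain ⟨b1, b2, b3⟩ := hcases j hj
      simp only at hij
      split_ifs at hij with c1 c2 c2
      · exact hij
      · have := b3.resolve_left c2
        nlinarith
      · have := a3.resolve_left c1
        nlinarith
      · linarith
    · intro j hj
      obtain ⟨h1, h2, h3⟩ := hcases j hj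
      split_ifs with hlt
      · rw [mass_succ_first_block h k h1 hlt, Real.mul_rpow (weight_nonneg _) (mass_nonneg _ _)]
        exact mul_le_mul_of_nonneg_right (le_max_left _ _) (mass_rpow_nonneg _ _ _)
      · rw [mass_succ_last_block h k (h3.resolve_left hlt) h2,
          Real.mul_rpow (weight_nonneg _) (mass_nonneg _ _)]
        exact mul_le_mul_of_nonneg_right (le_max_right _ _) (mass_rpow_nonneg _ _ _)
    · intro j _
      exact mul_nonneg ((Real.rpow_nonneg (weight_nonneg _) _).trans (le_max_left _ _))
        (mass_rpow_nonneg _ _ _)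

/-! ### Bounds for the folded power sums -/

lemma foldSum_zero_exponent (d n : ℕ) (p : PMF (Fin (m + 1))) :
    foldSum d p n 0 = (d : ℝ) ^ n := by
  unfold foldSum
  simp only [Real.rpow_zero, Finset.sum_const, Int.card_Ico, sub_zero, nsmul_eq_mul, mul_one]
  have : (((d : ℤ) ^ n).toNat : ℤ) = (d : ℤ) ^ n := Int.toNat_of_nonneg (by positivity)
  exact_mod_cast this

lemma foldSum_le_of_le (h : Admissible d m p) (n : ℕ) {q q' : ℝ} (hq : q ≤ q') :
    foldSum d p n q' ≤ 2 ^ (q' - q) * foldSum d p n q := by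
  unfold foldSum
  rw [Finset.mul_sum]
  refine Finset.sum_le_sum fun y hy => ?_
  obtain ⟨h1, h2⟩ := Finset.mem_Ico.1 hy
  have hpos := foldMass_pos h h1 h2
  rw [show q' = (q' - q) + q by ring, Real.rpow_add hpos, show (q' - q) + q - q = q' - q by ring]
  exact mul_le_mul_of_nonneg_right
    (Real.rpow_le_rpow hpos.le (foldMass_le_two _ _) (by linarith)) (Real.rpow_nonneg hpos.le _)

lemma le_foldSum_of_le (h : Admissible d m p) (n : ℕ) {q q' : ℝ} (hq : q ≤ q') :
    (weight p 0 ^ n) ^ (q' - q) * foldSum d p n q ≤ foldSum d p n q' := by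
  unfold foldSum
  rw [Finset.mul_sum]
  refine Finset.sum_le_sum fun y hy => ?_
  obtain ⟨h1, h2⟩ := Finset.mem_Ico.1 hy
  have hpos := foldMass_pos h h1 h2
  have hp0 := pow_pos (weight_pos_zero h) n
  have e : foldMass d p n y ^ q' = foldMass d p n y ^ (q' - q) * foldMass d p n y ^ q := by
    rw [← Real.rpow_add hpos]
    congr 1
    ring
  rw [e]
  exact mul_le_mul_of_nonneg_right
    (Real.rpow_le_rpow hp0.le (pow_le_foldMass h h1 h2) (by linarith)) (Real.rpow_nonneg hpos.le _)

lemma foldMass_rpow_le_foldSum {n : ℕ} {y : ℤ} (h0 : 0 ≤ y) (hy : y < (d : ℤ) ^ n) (q : ℝ) :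
    foldMass d p n y ^ q ≤ foldSum d p n q :=
  Finset.single_le_sum (f := fun y => foldMass d p n y ^ q)
    (fun y _ => foldMass_rpow_nonneg n y q) (Finset.mem_Ico.2 ⟨h0, hy⟩)

lemma foldSum_le_of_forall_le {n : ℕ} {c q : ℝ} (hc : 0 < c) (hq : q ≤ 0)
    (hle : ∀ y : ℤ, 0 ≤ y → y < (d : ℤ) ^ n → c ≤ foldMass d p n y) :
    foldSum d p n q ≤ (d : ℝ) ^ n * c ^ q := by
  calc foldSum d p n q ≤ ∑ _y ∈ Finset.Ico (0 : ℤ) ((d : ℤ) ^ n), c ^ q :=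
        Finset.sum_le_sum fun y hy => Real.rpow_le_rpow_of_nonpos hc
          (hle y (Finset.mem_Ico.1 hy).1 (Finset.mem_Ico.1 hy).2) hq
    _ = (d : ℝ) ^ n * c ^ q := by
        rw [Finset.sum_const, Int.card_Ico, sub_zero, nsmul_eq_mul]
        congr 1
        have : (((d : ℤ) ^ n).toNat : ℤ) = (d : ℤ) ^ n := Int.toNat_of_nonneg (by positivity)
        exact_mod_cast this

/-- The witness is the value of the word 1…1, whose letters weigh at least p_m. -/
lemma exists_pow_le_mass (h : Admissible d m p) (n : ℕ) :
    ∃ y : ℤ, 0 ≤ y ∧ y < (d : ℤ) ^ n ∧ weight p (Fin.last m) ^ n ≤ mass d p n y := by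
  have h3 := h.three_le
  have hle := h.le
  induction n with
  | zero => exact ⟨0, le_rfl, by simp, by simp [mass_zero]⟩
  | succ n ih =>
    obtain ⟨y, hy0, hy, hm⟩ := ih
    have hM := pow_pos_int h n
    have hd : (3 : ℤ) ≤ d := by omega
    refine ⟨(d : ℤ) ^ n * 1 + y, by omega, by rw [pow_succ]; nlinarith, ?_⟩
    rw [add_comm n 1, mass_add h 1 n 1 hy0 hy, add_comm 1 n, pow_succ', mass_one]
    have h1 := mul_le_mul (weight_last_le h le_rfl (by omega)) hm
      (pow_nonneg (weight_nonneg _) _) (weightExt_nonneg 1)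
    have h2 := mul_nonneg (mass_nonneg (d := d) (p := p) 1 (1 - 1))
      (mass_nonneg (d := d) (p := p) n (y + (d : ℤ) ^ n))
    linarith

lemma last_pow_le_foldSum (h : Admissible d m p) (n : ℕ) {q : ℝ} (hq : 0 ≤ q) :
    (weight p (Fin.last m) ^ n) ^ q ≤ foldSum d p n q := by
  obtain ⟨y, hy0, hy, hm⟩ := exists_pow_le_mass h n
  refine le_trans (Real.rpow_le_rpow (pow_nonneg (weight_nonneg _) _) ?_ hq)
    (foldMass_rpow_le_foldSum hy0 hy q)
  exact hm.trans (le_add_of_nonneg_right (mass_nonneg _ _))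

/-! ### Growth rates of sequences -/

/-- Fekete's lemma for a sequence that is superadditive from the index `ℓ` on. -/
lemma exists_tendsto_of_superadditive {u : ℕ → ℝ} {ℓ : ℕ} (hℓ : 0 < ℓ)
    (hu : ∀ i, ℓ ≤ i → ∀ j, ℓ ≤ j → u i + u j ≤ u (i + j)) {C : ℝ}
    (hC : ∀ n, ℓ ≤ n → u n ≤ C * n) :
    ∃ L : ℝ, Tendsto (fun n : ℕ => u n / n) atTop (𝓝 L) ∧ ∀ n, ℓ ≤ n → u n / n ≤ L := by
  have hmul : ∀ n, ℓ ≤ n → ∀ s, ℓ ≤ s → ∀ k : ℕ, k * u n + u s ≤ u (n * k + s) := by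
    intro n hn s hs k
    induction k with
    | zero => simp
    | succ k ih =>
      have := hu n hn (n * k + s) (by omega)
      rw [show n * (k + 1) + s = n + (n * k + s) by ring]
      push_cast
      linarith
  have hbdd : BddAbove ((fun n : ℕ => u n / n) '' Set.Ici ℓ) := by
    refine ⟨C, ?_⟩
    rintro _ ⟨n, hn, rfl⟩
    have hn' : (0 : ℝ) < n := by exact_mod_cast hℓ.trans_le hn
    exact (div_le_iff₀ hn').2 (hC n hn)
  have hle : ∀ n, ℓ ≤ n → u n / n ≤ sSup ((fun n : ℕ => u n / n) '' Set.Ici ℓ) :=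
    fun n hn => le_csSup hbdd ⟨n, hn, rfl⟩
  refine ⟨_, tendsto_order.2 ⟨fun L hL => ?_, fun L hL => ?_⟩, hle⟩
  · obtain ⟨_, ⟨n, hn, rfl⟩, hlt⟩ := exists_lt_of_lt_csSup
      (Set.nonempty_Ici.image fun n : ℕ => u n / n) hL
    have hn0 : n ≠ 0 := by
      have : ℓ ≤ n := hn
      omega
    have hn0' : (n : ℝ) ≠ 0 := by exact_mod_cast hn0
    refine .atTop_of_arithmetic hn0 fun r _ => ?_
    have A : Tendsto (fun x : ℝ => (u n + u (n + r) / x) / (n + ((n + r : ℕ) : ℝ) / x)) atTop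
        (𝓝 ((u n + 0) / (n + 0))) :=
      (tendsto_const_nhds.add <| tendsto_const_nhds.div_atTop tendsto_id).div
        (tendsto_const_nhds.add <| tendsto_const_nhds.div_atTop tendsto_id) <| by simpa
    have B : Tendsto (fun x : ℝ => (x * u n + u (n + r)) / (n * x + ((n + r : ℕ) : ℝ))) atTop
        (𝓝 (u n / n)) := by
      rw [add_zero, add_zero] at A
      refine A.congr' <| (eventually_ne_atTop 0).mono fun x hx => ?_
      field_simp
    have E := (B.comp tendsto_natCast_atTop_atTop).eventually (lt_mem_nhds hlt)
    filter_upwards [(tendsto_sub_atTop_nat 1).eventually E, eventually_ge_atTop 1] with k hk hk1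
    refine hk.trans_le ?_
    obtain ⟨k, rfl⟩ : ∃ k', k = k' + 1 := ⟨k - 1, by omega⟩
    -- Superadditivity is available only from ℓ on, so one period n is kept in the remainder: n + r
    -- ≥ ℓ, whereas r alone may be too small.
    have hs := hmul n hn (n + r) (le_add_right hn) k
    have e : n * (k + 1) + r = n * k + (n + r) := by ring
    simp only [Function.comp_apply, Nat.add_sub_cancel]
    rw [e]
    push_cast at hs ⊢
    gcongr
  · filter_upwards [eventually_ge_atTop ℓ] with n hn
    exact (hle n hn).trans_lt hL

lemma tendsto_div_of_abs_sub_le {a b B : ℕ → ℝ} {L : ℝ}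
    (ha : Tendsto (fun n : ℕ => a n / n) atTop (𝓝 L))
    (hab : ∀ᶠ n in atTop, |b n - a n| ≤ B n)
    (hB : Tendsto (fun n : ℕ => B n / n) atTop (𝓝 0)) :
    Tendsto (fun n : ℕ => b n / n) atTop (𝓝 L) := by
  have h1 : Tendsto (fun n : ℕ => (b n - a n) / n) atTop (𝓝 0) := by
    refine squeeze_zero_norm' ?_ hB
    filter_upwards [hab] with n hn
    rw [Real.norm_eq_abs, abs_div, Nat.abs_cast]
    gcongr
  have := ha.add h1
  rw [add_zero] at this
  refine this.congr fun n => ?_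
  ring

lemma tendsto_add_div_iff {a : ℕ → ℝ} {L : ℝ} (s : ℕ) :
    Tendsto (fun n : ℕ => a (s + n) / n) atTop (𝓝 L) ↔
      Tendsto (fun n : ℕ => a n / n) atTop (𝓝 L) := by
  rw [← tendsto_add_atTop_iff_nat (f := fun n : ℕ => a n / n) s]
  have h0 : Tendsto (fun n : ℕ => (s : ℝ) / n) atTop (𝓝 0) :=
    tendsto_const_nhds.div_atTop tendsto_natCast_atTop_atTop
  have h1 : Tendsto (fun n : ℕ => 1 + (s : ℝ) / n) atTop (𝓝 1) := by
    simpa using h0.const_add 1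
  have hne : ∀ᶠ n : ℕ in atTop, (n : ℝ) ≠ 0 := by
    filter_upwards [eventually_ne_atTop 0] with n hn
    exact_mod_cast hn
  constructor
  · intro H
    have := H.div h1 one_ne_zero
    rw [div_one] at this
    refine this.congr' ?_
    filter_upwards [hne] with n hn
    have : (0 : ℝ) < n := by positivity
    simp only [Pi.div_apply]
    rw [add_comm n s]
    push_cast
    field_simp
    ring
  · intro H
    have := H.mul h1
    rw [mul_one] at this
    refine this.congr' ?_
    filter_upwards [hne] with n hn
    have : (0 : ℝ) < n := by positivity
    rw [add_comm n s]
    push_cast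
    field_simp
    ring

lemma tendsto_const_div_nat (c : ℝ) : Tendsto (fun n : ℕ => c / (n : ℝ)) atTop (𝓝 0) :=
  tendsto_const_nhds.div_atTop tendsto_natCast_atTop_atTop

lemma abs_log_sub_log_le {a b C : ℝ} (ha : 0 < a) (hb : 0 < b) (hC : 0 < C) (hab : a ≤ C * b)
    (hba : b ≤ C * a) : |Real.log a - Real.log b| ≤ Real.log C := by
  have h1 := Real.log_le_log ha hab
  have h2 := Real.log_le_log hb hba
  rw [Real.log_mul hC.ne' hb.ne'] at h1
  rw [Real.log_mul hC.ne' ha.ne'] at h2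
  rw [abs_le]
  constructor <;> linarith

lemma tendsto_log_div_iff {f g : ℕ → ℝ} {C L : ℝ} (s : ℕ) (hC : 0 < C) (hg : ∀ n, 0 < g n)
    (hfg : ∀ n, f (s + n) ≤ C * g n) (hgf : ∀ n, g n ≤ C * f (s + n)) :
    Tendsto (fun n : ℕ => Real.log (f n) / n) atTop (𝓝 L) ↔
      Tendsto (fun n : ℕ => Real.log (g n) / n) atTop (𝓝 L) := by
  have hf : ∀ n, 0 < f (s + n) := fun n => pos_of_mul_pos_right ((hg n).trans_le (hgf n)) hC.le
  rw [← tendsto_add_div_iff (a := fun n => Real.log (f n)) s]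
  constructor
  · exact fun H => tendsto_div_of_abs_sub_le H (.of_forall fun n =>
      abs_log_sub_log_le (hg n) (hf n) hC (hgf n) (hfg n)) (tendsto_const_div_nat _)
  · exact fun H => tendsto_div_of_abs_sub_le H (.of_forall fun n =>
      abs_log_sub_log_le (hf n) (hg n) hC (hfg n) (hgf n)) (tendsto_const_div_nat _)

/-- Linear growth in n makes the comparison of neighbouring masses invisible to exponential rates.
-/
lemma tendsto_log_ratioBound (h : Admissible d m p) :
    Tendsto (fun n : ℕ => Real.log (ratioBound p n) / n) atTop (𝓝 0) := by
  have hp0 := weight_pos_zero h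
  have h1 : Tendsto (fun n : ℕ => Real.log (n : ℝ) / n) atTop (𝓝 0) :=
    Real.isLittleO_log_id_atTop.tendsto_div_nhds_zero.comp tendsto_natCast_atTop_atTop
  refine tendsto_div_of_abs_sub_le (B := fun _ => Real.log 2 + |Real.log (weight p 0)|) h1 ?_
    (tendsto_const_div_nat _)
  filter_upwards [eventually_ge_atTop 1] with n hn
  have hn' : (1 : ℝ) ≤ n := by exact_mod_cast hn
  unfold ratioBound
  rw [Real.log_div (by positivity) hp0.ne']
  have e1 : Real.log n ≤ Real.log (n + 1) := Real.log_le_log (by linarith) (by linarith)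
  have e2 : Real.log (n + 1) ≤ Real.log 2 + Real.log n := by
    rw [← Real.log_mul (by norm_num) (by linarith)]
    exact Real.log_le_log (by linarith) (by linarith)
  have e3 := neg_abs_le (Real.log (weight p 0))
  have e4 := le_abs_self (Real.log (weight p 0))
  rw [abs_le]
  constructor <;> linarith [Real.log_nonneg (by norm_num : (1 : ℝ) ≤ 2)]

/-! ### Growth rate of the folded power sums -/

/-- `L` is the growth rate of the folded power sums with exponent `q`. -/
def IsGrowth (d : ℕ) {m : ℕ} (p : PMF (Fin (m + 1))) (q L : ℝ) : Prop :=
  Tendsto (fun n : ℕ => Real.log (foldSum d p n q) / n) atTop (𝓝 L)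

lemma tendsto_windowSum_iff (h : Admissible d m p) {u v : ℝ} (hu : 0 < u) (huv : u < v)
    (hv : v < xi d m) {q L : ℝ} :
    Tendsto (fun n : ℕ => Real.log (windowSum d p u v n q) / n) atTop (𝓝 L) ↔
      IsGrowth d p q L := by
  obtain ⟨s, C, hC, hs⟩ := windowSum_comparable h hu huv hv q
  exact tendsto_log_div_iff s hC (foldSum_pos h · q) (fun n => (hs n).1) (fun n => (hs n).2)

/-- Fekete's lemma for a window inside (ξ - 1, 1). The limit is stated for `foldSum`, which does not
depend on the window, so it transfers to every interior interval. -/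
lemma exists_growth (h : Admissible d m p) {u v : ℝ} (hu : xi d m - 1 < u) (huv : u < v)
    (hv : v < 1) {ℓ : ℕ} (hℓ : 0 < ℓ) (hne : ∀ n, ℓ ≤ n → (window d m u v n).Nonempty) (q : ℝ) :
    ∃ L : ℝ, IsGrowth d p q L ∧ ∀ n, ℓ ≤ n → Real.log (windowSum d p u v n q) / n ≤ L := by
  have hxi := xi_bounds h
  have hp0 := weight_pos_zero h
  have hu0 : 0 < u := by linarith
  have hvx : v < xi d m := by linarith
  have hpos : ∀ n, ℓ ≤ n → 0 < windowSum d p u v n q :=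
    fun n hn => windowSum_pos h hu0.le hvx.le (hne n hn) q
  have hd0 : (0 : ℝ) < d := by have := h.three_le; exact_mod_cast (by omega : 0 < d)
  have hsup : ∀ i, ℓ ≤ i → ∀ j, ℓ ≤ j → Real.log (windowSum d p u v i q) +
      Real.log (windowSum d p u v j q) ≤ Real.log (windowSum d p u v (i + j) q) := by
    intro i hi j hj
    rw [← Real.log_mul (hpos i hi).ne' (hpos j hj).ne']
    exact Real.log_le_log (mul_pos (hpos i hi) (hpos j hj)) (windowSum_mul_le h hu hv q i j)
  have hbdd : ∀ n, ℓ ≤ n → Real.log (windowSum d p u v n q) ≤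
      (Real.log 2 + Real.log d + Real.log ((weight p 0)⁻¹ ^ |q|)) * n := by
    intro n hn
    have hn1 : (1 : ℝ) ≤ n := by exact_mod_cast hℓ.trans_le hn
    have h1 := Real.log_le_log (hpos n hn) (windowSum_le h hu0.le hvx.le n q)
    have hc : 0 < (weight p 0)⁻¹ ^ |q| := Real.rpow_pos_of_pos (inv_pos.2 hp0) _
    rw [Real.log_mul (by positivity) (by positivity), Real.log_mul (by positivity) (by positivity),
      Real.log_pow, Real.log_pow] at h1
    have h2 := Real.log_nonneg (by norm_num : (1 : ℝ) ≤ 2)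
    nlinarith
  obtain ⟨L, hL, hle⟩ := exists_tendsto_of_superadditive hℓ hsup hbdd
  exact ⟨L, (tendsto_windowSum_iff h hu0 huv hvx).1 hL, hle⟩

section Growth

variable {q q' L L' : ℝ}

lemma growth_antitone (h : Admissible d m p) (hL : IsGrowth d p q L) (hL' : IsGrowth d p q' L')
    (hq : q ≤ q') : L' ≤ L := by
  have hB := tendsto_const_div_nat ((q' - q) * Real.log 2)
  have := hB.add hL
  rw [zero_add] at this
  refine le_of_tendsto_of_tendsto' hL' this fun n => ?_
  have h1 := Real.log_le_log (foldSum_pos h n q') (foldSum_le_of_le h n hq)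
  rw [Real.log_mul (by positivity) (foldSum_pos h n q).ne', Real.log_rpow (by norm_num)] at h1
  rw [← add_div]
  gcongr

lemma growth_lipschitz (h : Admissible d m p) (hL : IsGrowth d p q L) (hL' : IsGrowth d p q' L')
    (hq : q ≤ q') : (q' - q) * Real.log (weight p 0) + L ≤ L' := by
  have hp0 := weight_pos_zero h
  refine le_of_tendsto_of_tendsto (hL.const_add _) hL' ?_
  filter_upwards [eventually_gt_atTop 0] with n hn
  have hn' : (0 : ℝ) < n := by exact_mod_cast hn
  have h1 := Real.log_le_log (mul_pos (by positivity) (foldSum_pos h n q)) (le_foldSum_of_le h n hq)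
  rw [Real.log_mul (by positivity) (foldSum_pos h n q).ne', Real.log_rpow (by positivity),
    Real.log_pow] at h1
  rw [le_div_iff₀ hn', add_mul, div_mul_cancel₀ _ hn'.ne']
  linarith

lemma growth_zero_exponent (hL : IsGrowth d p 0 L) : L = Real.log d := by
  refine tendsto_nhds_unique hL (tendsto_const_nhds.congr' ?_)
  filter_upwards [eventually_gt_atTop 0] with n hn
  have hn' : (n : ℝ) ≠ 0 := by exact_mod_cast hn.ne'
  rw [foldSum_zero_exponent, Real.log_pow]
  field_simp

lemma mul_log_last_le_growth (h : Admissible d m p) (hL : IsGrowth d p q L) (hq : 0 ≤ q) :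
    q * Real.log (weight p (Fin.last m)) ≤ L := by
  have hpm := (weight_pos_zero h).trans_le (weight_zero_le_last h)
  refine ge_of_tendsto hL ?_
  filter_upwards [eventually_gt_atTop 0] with n hn
  have hn' : (0 : ℝ) < n := by exact_mod_cast hn
  have h1 := Real.log_le_log (by positivity) (last_pow_le_foldSum h n hq)
  rw [Real.log_rpow (by positivity), Real.log_pow] at h1
  rw [le_div_iff₀ hn']
  linarith

lemma mul_log_first_le_growth (h : Admissible d m p) (hL : IsGrowth d p q L) (hq : 0 ≤ q) :
    q * Real.log (weight p 0) ≤ L :=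
  (mul_le_mul_of_nonneg_left (Real.log_le_log (weight_pos_zero h) (weight_zero_le_last h)) hq).trans
    (mul_log_last_le_growth h hL hq)

/-- For q ≤ 0 each of the d^n terms is largest at the smallest folded mass; the factor 2
`ratioBound` and the shift from n to n + 1 do not affect the rate. -/
lemma growth_le_of_le_foldMass (h : Admissible d m p) (hL : IsGrowth d p q L) (hq : q ≤ 0) {r : ℝ}
    (hr : 0 < r) (hle : ∀ (n : ℕ) (y : ℤ), 0 ≤ y → y < (d : ℤ) ^ n →
      r ^ (n + 1) ≤ 2 * ratioBound p (n + 1) * foldMass d p n y) :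
    L ≤ Real.log d + q * Real.log r := by
  have h1 := (tendsto_add_div_iff (a := fun n => Real.log (ratioBound p n)) 1).2
    (tendsto_log_ratioBound h)
  have h2 := tendsto_const_div_nat (q * (Real.log r - Real.log 2))
  have h3 := (((h1.const_mul q).neg).add h2).const_add (Real.log d + q * Real.log r)
  simp only [mul_zero, neg_zero, add_zero] at h3
  refine le_of_tendsto_of_tendsto hL h3 ?_
  filter_upwards [eventually_gt_atTop 0] with n hn
  have hn' : (0 : ℝ) < n := by exact_mod_cast hn
  have hD := one_le_ratioBound h (n + 1)
  have hD0 : 0 < ratioBound p (n + 1) := by linarith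
  have hd0 : (0 : ℝ) < d := by have := h.three_le; exact_mod_cast (by omega : 0 < d)
  have hc : 0 < r ^ (n + 1) / (2 * ratioBound p (n + 1)) := by positivity
  have h4 := Real.log_le_log (foldSum_pos h n q) (foldSum_le_of_forall_le hc hq fun y hy0 hy =>
    (div_le_iff₀ (by positivity)).2 ((hle n y hy0 hy).trans_eq (mul_comm _ _)))
  rw [Real.log_mul (by positivity) (by positivity), Real.log_rpow hc, Real.log_div (by positivity)
    (by positivity), Real.log_mul (by norm_num) hD0.ne', Real.log_pow, Real.log_pow] at h4
  rw [add_comm 1 n, div_le_iff₀ hn']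
  push_cast at h4
  refine h4.trans_eq ?_
  field_simp
  ring

/-- The lower bound comes from an interior block and from the single term j = 0; the upper bound
iterates `fullSum_succ_le`. -/
lemma tendsto_fullSum (h : Admissible d m p) (hL : IsGrowth d p q L) :
    Tendsto (fun n : ℕ => Real.log (fullSum d p n q) / n) atTop
      (𝓝 (max L (q * Real.log (weight p 0)))) := by
  have hp0 := weight_pos_zero h
  have hB := one_le_blockConst h 1 q
  set M := max L (q * Real.log (weight p 0)) with hM
  set lam := max (weight p 0 ^ q) (weight p (Fin.last m) ^ q) with hlam
  -- The digit m creates no third rate: for q ≥ 0 the word 1…1 gives q log p_m ≤ L, and for q ≤ 0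
  -- one has p_m^q ≤ p_0^q.
  have hlamM : lam ≤ Real.exp M := by
    have e0 : weight p 0 ^ q ≤ Real.exp M := by
      rw [Real.rpow_def_of_pos hp0, Real.exp_le_exp, mul_comm]
      exact le_max_right _ _
    refine max_le e0 ?_
    rcases le_total 0 q with hq | hq
    · rw [Real.rpow_def_of_pos (hp0.trans_le (weight_zero_le_last h)), Real.exp_le_exp, mul_comm]
      exact (mul_log_last_le_growth h hL hq).trans (le_max_left _ _)
    · exact (Real.rpow_le_rpow_of_nonpos hp0 (weight_zero_le_last h) hq).trans e0
  refine tendsto_order.2 ⟨fun K hK => ?_, fun K hK => ?_⟩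
  · rcases lt_max_iff.1 hK with hK | hK
    · have h1 : Tendsto (fun n : ℕ => (Real.log (foldSum d p n q) - Real.log (blockConst p 1 q)) / n)
          atTop (𝓝 L) := by
        have := hL.sub (tendsto_const_div_nat (Real.log (blockConst p 1 q)))
        rw [sub_zero] at this
        exact this.congr fun n => by ring
      have h2 := (tendsto_add_div_iff
        (a := fun n => Real.log (foldSum d p (n - 1) q) - Real.log (blockConst p 1 q)) 1).1
        (by simpa using h1)
      filter_upwards [h2.eventually (lt_mem_nhds hK), eventually_ge_atTop 1] with n hn hn1
      refine hn.trans_le ?_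
      obtain ⟨k, rfl⟩ : ∃ k, n = k + 1 := ⟨n - 1, by omega⟩
      have h3 := Real.log_le_log (foldSum_pos h k q) (foldSum_le_fullSum h k q)
      rw [Real.log_mul (by linarith) (fullSum_pos h _ q).ne'] at h3
      rw [Nat.add_sub_cancel]
      gcongr
      linarith
    · filter_upwards [eventually_gt_atTop 0] with n hn
      have hn' : (0 : ℝ) < n := by exact_mod_cast hn
      refine hK.trans_le ?_
      have h3 := Real.log_le_log (by positivity) (pow_le_fullSum h n q)
      rw [Real.log_pow, Real.log_rpow hp0] at h3
      rw [le_div_iff₀ hn']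
      linarith
  · obtain ⟨K', hMK', hK'K⟩ := exists_between hK
    obtain ⟨N, hN⟩ := eventually_atTop.1
      (hL.eventually (gt_mem_nhds ((le_max_left _ _).trans_lt hMK')))
    obtain ⟨A, hA⟩ : ∃ A : ℝ, 0 < A ∧ ∀ n, foldSum d p n q ≤ A * Real.exp K' ^ n := by
      refine ⟨1 + ∑ i ∈ Finset.range (N + 1), foldSum d p i q / Real.exp K' ^ i, ?_, fun n => ?_⟩
      · have : 0 ≤ ∑ i ∈ Finset.range (N + 1), foldSum d p i q / Real.exp K' ^ i :=
          Finset.sum_nonneg fun i _ => div_nonneg (foldSum_pos h i q).le (by positivity)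
        linarith
      · rw [← div_le_iff₀ (by positivity)]
        have hs : ∀ i ∈ Finset.range (N + 1), 0 ≤ foldSum d p i q / Real.exp K' ^ i :=
          fun i _ => div_nonneg (foldSum_pos h i q).le (by positivity)
        rcases lt_or_ge n (N + 1) with hn | hn
        · have := Finset.single_le_sum hs (Finset.mem_range.2 hn)
          linarith
        · have hn' : (0 : ℝ) < n := by exact_mod_cast (by omega : 0 < n)
          have h1 := hN n (by omega)
          rw [div_lt_iff₀ hn', Real.log_lt_iff_lt_exp (foldSum_pos h n q), mul_comm,
            Real.exp_nat_mul] at h1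
          have h2 : foldSum d p n q / Real.exp K' ^ n ≤ 1 := (div_le_one (by positivity)).2 h1.le
          have := Finset.sum_nonneg hs
          linarith
    obtain ⟨hA0, hA⟩ := hA
    have hgap : 0 < Real.exp K' - Real.exp M := sub_pos.2 (Real.exp_lt_exp.2 hMK')
    -- `D` covers level 0 and satisfies m B A + D exp M ≤ D exp K' with B = `blockConst p 1 q`, so
    -- that the recursion preserves the bound.
    set D := fullSum d p 0 q + m * blockConst p 1 q * A / (Real.exp K' - Real.exp M) with hD
    have hDq : 0 ≤ m * blockConst p 1 q * A / (Real.exp K' - Real.exp M) := by positivity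
    have hD0 : 0 < D := add_pos_of_pos_of_nonneg (fullSum_pos h 0 q) hDq
    have hbound : ∀ n, fullSum d p n q ≤ D * Real.exp K' ^ n := by
      intro n
      induction n with
      | zero => rw [pow_zero, mul_one]; linarith
      | succ n ih =>
        have h1 := fullSum_succ_le h n q
        have h2 : m * blockConst p 1 q * foldSum d p n q ≤
            m * blockConst p 1 q * (A * Real.exp K' ^ n) :=
          mul_le_mul_of_nonneg_left (hA n) (by positivity)
        have h3 : lam * fullSum d p n q ≤ Real.exp M * (D * Real.exp K' ^ n) :=
          mul_le_mul hlamM ih (fullSum_pos h n q).le (Real.exp_pos _).le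
        have h4 : m * blockConst p 1 q * A ≤ D * (Real.exp K' - Real.exp M) := by
          rw [← div_le_iff₀ hgap]
          have := fullSum_pos h 0 q
          linarith
        have h5 := mul_le_mul_of_nonneg_right h4 (pow_pos (Real.exp_pos K') n).le
        rw [pow_succ]
        linarith
    have hlim : Tendsto (fun n : ℕ => Real.log D / n + K') atTop (𝓝 K') := by
      simpa using (tendsto_const_div_nat (Real.log D)).add_const K'
    filter_upwards [hlim.eventually (gt_mem_nhds hK'K), eventually_gt_atTop 0] with n hn hn0
    have hn' : (0 : ℝ) < n := by exact_mod_cast hn0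
    refine lt_of_le_of_lt ?_ hn
    have h1 := Real.log_le_log (fullSum_pos h n q) (hbound n)
    rw [Real.log_mul hD0.ne' (by positivity), Real.log_pow, Real.log_exp] at h1
    rw [div_le_iff₀ hn', add_mul, div_mul_cancel₀ _ hn'.ne']
    linarith

end Growth

/-- The point where a function `P` crosses the line `q ↦ c q`. -/
lemma exists_threshold {P : ℝ → ℝ} {c : ℝ} (hanti : ∀ q q', q ≤ q' → P q' ≤ P q)
    (hmono : ∀ q q', q ≤ q' → (q' - q) * c + P q ≤ P q') (h0 : 0 < P 0)
    (hneg : ∃ q, P q ≤ q * c) :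
    ∃ q₀ : ℝ, q₀ < 0 ∧ (∀ q, q ≤ q₀ → P q ≤ q * c) ∧ ∀ q, q₀ < q → q * c ≤ P q := by
  set S := {q : ℝ | P q ≤ q * c} with hS
  have hS0 : ∀ q ∈ S, q ≤ 0 := by
    intro q hq
    by_contra! hpos
    have h1 := hmono 0 q hpos.le
    have h2 : P q ≤ q * c := hq
    linarith
  have hbdd : BddAbove S := ⟨0, hS0⟩
  -- By `hmono` the function P(q) - qc is nondecreasing, so S is closed downwards. At the supremum
  -- itself, `hanti` bounds P by its values at points of S just to the left, so S contains its
  -- supremum.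
  have hdown : ∀ q, q ≤ sSup S → q ∈ S := by
    intro q hq
    rcases hq.lt_or_eq with hlt | heq
    · obtain ⟨q', hq', hlt'⟩ := exists_lt_of_lt_csSup hneg hlt
      have h1 := hmono q q' hlt'.le
      have h2 : P q' ≤ q' * c := hq'
      change P q ≤ q * c
      linarith
    · change P q ≤ q * c
      refine le_of_forall_pos_le_add fun ε hε => ?_
      have hε' : 0 < ε / (|c| + 1) := by positivity
      obtain ⟨q', hq', hlt'⟩ := exists_lt_of_lt_csSup hneg
        (show sSup S - ε / (|c| + 1) < sSup S by linarith)
      have hle : q' ≤ q := heq ▸ le_csSup hbdd hq'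
      have h1 := hanti q' q hle
      have h2 : P q' ≤ q' * c := hq'
      have h3 : (q - q') * |c| ≤ ε := by
        have : q - q' ≤ ε / (|c| + 1) := by linarith
        calc (q - q') * |c| ≤ ε / (|c| + 1) * (|c| + 1) :=
              mul_le_mul this (by linarith) (abs_nonneg _) hε'.le
          _ = ε := by field_simp
      have h4 : -((q - q') * c) ≤ (q - q') * |c| := by
        have := neg_abs_le c
        nlinarith
      linarith
  refine ⟨sSup S, ?_, hdown, fun q hq => ?_⟩
  · refine lt_of_le_of_ne (csSup_le hneg hS0) fun heq => ?_
    have : P 0 ≤ 0 * c := hdown 0 heq.ge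
    linarith
  · by_contra! hlt
    exact absurd (le_csSup hbdd (show q ∈ S from hlt.le)) (not_le.2 hq)

/-! ### The projection of infinite words -/

lemma hasSum_geometric_shift (hd : 3 ≤ d) :
    HasSum (fun i : ℕ => (m : ℝ) / (d : ℝ) ^ (i + 1)) (xi d m) := by
  have hd' : (3 : ℝ) ≤ d := by exact_mod_cast hd
  have h1 := (hasSum_geometric_of_lt_one (r := (d : ℝ)⁻¹) (by positivity)
    (inv_lt_one_of_one_lt₀ (by linarith))).mul_left ((m : ℝ) / d)
  have h2 : (m : ℝ) / d * (1 - (d : ℝ)⁻¹)⁻¹ = xi d m := by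
    have : (d : ℝ) - 1 ≠ 0 := by linarith
    have h0 : (d : ℝ) ≠ 0 := by linarith
    unfold xi
    field_simp
  rw [h2] at h1
  refine h1.congr_fun fun i => ?_
  rw [pow_succ, inv_pow]
  field_simp

lemma digit_div_le (ω : ℕ → Fin (m + 1)) (i : ℕ) :
    ((ω i : ℕ) : ℝ) / (d : ℝ) ^ (i + 1) ≤ (m : ℝ) / (d : ℝ) ^ (i + 1) := by
  have : ((ω i : ℕ) : ℝ) ≤ m := by exact_mod_cast (by have := (ω i).2; omega : (ω i : ℕ) ≤ m)
  gcongr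

lemma summable_proj (hd : 3 ≤ d) (ω : ℕ → Fin (m + 1)) :
    Summable fun i : ℕ => ((ω i : ℕ) : ℝ) / (d : ℝ) ^ (i + 1) :=
  Summable.of_nonneg_of_le (fun i => by positivity) (digit_div_le ω)
    (hasSum_geometric_shift hd).summable

lemma proj_nonneg (ω : ℕ → Fin (m + 1)) : 0 ≤ proj d ω :=
  tsum_nonneg fun i => by positivity

lemma proj_le_xi (hd : 3 ≤ d) (ω : ℕ → Fin (m + 1)) : proj d ω ≤ xi d m := by
  rw [← (hasSum_geometric_shift hd).tsum_eq]
  exact (summable_proj hd ω).tsum_le_tsum (digit_div_le ω) (hasSum_geometric_shift hd).summable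

lemma proj_const_last (hd : 3 ≤ d) : proj d (fun _ => Fin.last m) = xi d m :=
  (hasSum_geometric_shift hd).tsum_eq

lemma proj_const_zero : proj d (fun _ => (0 : Fin (m + 1))) = 0 := by simp [proj]

lemma proj_eq_add (hd : 3 ≤ d) (k : ℕ) (ω : ℕ → Fin (m + 1)) :
    proj d ω = projFin d (fun i : Fin k => ω i) + proj d (fun i => ω (i + k)) / (d : ℝ) ^ k := by
  unfold proj projFin
  rw [← (summable_proj hd ω).sum_add_tsum_nat_add k, Finset.sum_range, ← tsum_div_const]
  congr 1
  refine tsum_congr fun i => ?_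
  rw [div_div, ← pow_add]
  congr 2
  ring

lemma proj_mul_pow (hd : 3 ≤ d) (k : ℕ) (ω : ℕ → Fin (m + 1)) :
    proj d ω * (d : ℝ) ^ k = wordVal d (fun i : Fin k => ω i) + proj d (fun i => ω (i + k)) := by
  have hd0 : (d : ℝ) ^ k ≠ 0 := pow_ne_zero _ (by exact_mod_cast (by omega : d ≠ 0))
  rw [proj_eq_add hd k, add_mul, projFin_mul_pow (by omega), div_mul_cancel₀ _ hd0]

lemma measurable_proj (hd : 3 ≤ d) : Measurable (proj d : (ℕ → Fin (m + 1)) → ℝ) := by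
  refine measurable_of_tendsto_metrizable
    (f := fun n (ω : ℕ → Fin (m + 1)) => ∑ i ∈ Finset.range n, ((ω i : ℕ) : ℝ) / (d : ℝ) ^ (i + 1))
    (fun n => ?_) (tendsto_pi_nhds.2 fun ω => (summable_proj hd ω).hasSum.tendsto_sum_nat)
  refine Finset.measurable_sum _ fun i _ => ?_
  exact (measurable_from_top (f := fun a : Fin (m + 1) => ((a : ℕ) : ℝ) / (d : ℝ) ^ (i + 1))).comp
    (measurable_pi_apply i)

/-! ### Barrier words -/

/-- Continuing w by zeros and by the digit m gives the two ends of the cylinder interval of w, which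
therefore lies inside (ξ - 1, 1). -/
lemma barrier_bounds (hd : 3 ≤ d) {ℓ : ℕ} {w : Fin ℓ → Fin (m + 1)} (hw : IsBarrier d w) :
    xi d m - 1 < projFin d w ∧ projFin d w + xi d m / (d : ℝ) ^ ℓ < 1 := by
  have key : ∀ a : Fin (m + 1), ∃ ω : ℕ → Fin (m + 1), (∀ i : Fin ℓ, ω i = w i) ∧
      proj d ω = projFin d w + proj d (fun _ => a) / (d : ℝ) ^ ℓ := by
    intro a
    refine ⟨fun i => if hi : i < ℓ then w ⟨i, hi⟩ else a, fun i => by simp, ?_⟩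
    rw [proj_eq_add hd ℓ]
    simp
  constructor
  · obtain ⟨ω, h1, h2⟩ := key 0
    have := (hw ω h1).2.2
    rw [h2, proj_const_zero, zero_div] at this
    linarith
  · obtain ⟨ω, h1, h2⟩ := key (Fin.last m)
    have := (hw ω h1).1
    rw [h2, proj_const_last hd] at this
    linarith

lemma barrier_length_pos (h : Admissible d m p) {ℓ : ℕ} {w : Fin ℓ → Fin (m + 1)}
    (hw : IsBarrier d w) : 0 < ℓ := by
  rcases Nat.eq_zero_or_pos ℓ with rfl | hpos
  · have := (barrier_bounds h.three_le hw).1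
    have hxi := xi_bounds h
    rw [projFin, Finset.univ_eq_empty, Finset.sum_empty] at this
    linarith
  · exact hpos

lemma mem_barrier_window (h : Admissible d m p) {ℓ : ℕ} (w : Fin ℓ → Fin (m + 1)) (n : ℕ) (j : ℤ) :
    j ∈ window d m (projFin d w) (projFin d w + xi d m / (d : ℝ) ^ ℓ) (ℓ + n) ↔
      (d : ℤ) ^ n * wordVal d w ≤ j ∧ j ≤ (d : ℤ) ^ n * wordVal d w + top d m n := by
  have hd0 : (d : ℝ) ^ ℓ ≠ 0 := by have := one_le_pow_real h ℓ; linarith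
  have hw := projFin_mul_pow (d := d) (by have := h.three_le; omega) w
  have e1 : projFin d w * (d : ℝ) ^ (ℓ + n) = (((d : ℤ) ^ n * wordVal d w : ℤ) : ℝ) := by
    rw [pow_add, ← mul_assoc, hw]
    push_cast
    ring
  have e2 : (projFin d w + xi d m / (d : ℝ) ^ ℓ) * (d : ℝ) ^ (ℓ + n) =
      (((d : ℤ) ^ n * wordVal d w + top d m n : ℤ) : ℝ) + xi d m := by
    rw [add_mul, e1, pow_add]
    push_cast
    rw [top_eq_xi h.three_le]
    field_simp
    ring
  rw [mem_window, e1, e2, add_le_add_iff_right, Int.cast_le, Int.cast_le]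

/-- The values of (w, σ), for representatives σ, run exactly once through the window of the cylinder
interval of w, since every integer from 0 to `top d m n` is the value of a word. -/
lemma Shat_eq_windowSum (h : Admissible d m p) {Ξ : (k : ℕ) → Finset (Fin k → Fin (m + 1))}
    (hΞ : IsRepresentativeFamily d m Ξ) {ℓ : ℕ} (w : Fin ℓ → Fin (m + 1)) (n : ℕ) (q : ℝ) :
    Shat d p w Ξ n q =
      windowSum d p (projFin d w) (projFin d w + xi d m / (d : ℝ) ^ ℓ) (ℓ + n) q := by
  have hd0 : d ≠ 0 := by have := h.three_le; omega
  unfold Shat windowSum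
  refine Finset.sum_bij (fun σ _ => (d : ℤ) ^ n * wordVal d w + wordVal d σ) ?_ ?_ ?_ ?_
  · intro σ _
    rw [mem_barrier_window h]
    have h1 := wordVal_nonneg (d := d) σ
    have h2 := wordVal_le_top (d := d) σ
    constructor <;> linarith
  · intro σ hσ σ' hσ' heq
    exact (hΞ n).injOn hσ hσ' ((projFin_eq_iff hd0 _ _).2 (add_left_cancel heq))
  · intro j hj
    rw [mem_barrier_window h] at hj
    have hpos := mass_pos h (k := n) (j := j - (d : ℤ) ^ n * wordVal d w) (by linarith) (by linarith)
    obtain ⟨τ, hτ, -⟩ := Finset.exists_ne_zero_of_sum_ne_zero hpos.ne'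
    obtain ⟨σ, hσ, hστ⟩ := (hΞ n).surjOn ⟨τ, rfl⟩
    refine ⟨σ, hσ, ?_⟩
    rw [(projFin_eq_iff hd0 _ _).1 hστ, (Finset.mem_filter.1 hτ).2]
    ring
  · intro σ _
    rw [eta_eq_mass hd0, wordVal_append]

/-! ### Masses as measures -/

lemma bernoulli_cylinder {k : ℕ} (σ : Fin k → Fin (m + 1)) :
    bernoulli p {ω | (fun i : Fin k => ω i) = σ} = ENNReal.ofReal (wordWeight p σ) := by
  have hset : {ω : ℕ → Fin (m + 1) | (fun i : Fin k => ω i) = σ} =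
      Set.pi (Finset.range k) (fun i => {a | ∀ hi : i < k, a = σ ⟨i, hi⟩}) := by
    ext ω
    simp only [Set.mem_ofPred_eq, Set.mem_pi, Finset.coe_range, Set.mem_Iio, funext_iff]
    exact ⟨fun H i _ hi => H ⟨i, hi⟩, fun H i => H i i.2 i.2⟩
  rw [hset, bernoulli, Measure.infinitePi_pi _ (fun _ _ => DiscreteMeasurableSpace.forall_measurableSet _),
    Finset.prod_range, wordWeight, ENNReal.ofReal_prod_of_nonneg fun _ _ => weight_nonneg _]
  refine Finset.prod_congr rfl fun i _ => ?_
  have : {a : Fin (m + 1) | ∀ hi : (i : ℕ) < k, a = σ ⟨i, hi⟩} = {σ i} := by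
    ext a
    simp
  rw [this, PMF.toMeasure_apply_singleton _ _ (measurableSet_singleton _), weight,
    ENNReal.ofReal_toReal (p.apply_ne_top _)]

lemma measurableSet_cylinder {k : ℕ} (A : Set (Fin k → Fin (m + 1))) :
    MeasurableSet {ω : ℕ → Fin (m + 1) | (fun i : Fin k => ω i) ∈ A} :=
  (measurable_pi_lambda _ fun i : Fin k => measurable_pi_apply (i : ℕ))
    (DiscreteMeasurableSpace.forall_measurableSet A)

lemma bernoulli_wordVal (k : ℕ) (j : ℤ) :
    bernoulli p {ω | wordVal d (fun i : Fin k => ω i) = j} = ENNReal.ofReal (mass d p k j) := by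
  have hset : {ω : ℕ → Fin (m + 1) | wordVal d (fun i : Fin k => ω i) = j} =
      ⋃ σ ∈ Finset.univ.filter (fun σ : Fin k → Fin (m + 1) => wordVal d σ = j),
        {ω | (fun i : Fin k => ω i) = σ} := by
    ext ω
    simp
  rw [hset, measure_biUnion_finset, mass,
    ENNReal.ofReal_sum_of_nonneg fun _ _ => wordWeight_nonneg _]
  · exact Finset.sum_congr rfl fun σ _ => bernoulli_cylinder σ
  · intro σ _ σ' _ hne
    refine Set.disjoint_left.2 fun ω hω hω' => hne ?_
    exact (show _ = σ from hω).symm.trans hω'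
  · exact fun σ _ => measurableSet_cylinder {σ}

/-- By `proj_mul_pow`, d^k π(ω) is the value of the first k letters plus a tail in [0, ξ], so words
with value j project into the cell [j, j + ξ] / d^k. -/
lemma mass_le_selfSimilar (hd : 3 ≤ d) {k : ℕ} {j : ℤ} {E : Set ℝ} (hE : MeasurableSet E)
    (hj : ∀ x : ℝ, (j : ℝ) ≤ x * (d : ℝ) ^ k → x * (d : ℝ) ^ k ≤ j + xi d m → x ∈ E) :
    ENNReal.ofReal (mass d p k j) ≤ selfSimilar d p E := by
  rw [selfSimilar, Measure.map_apply (measurable_proj hd) hE, ← bernoulli_wordVal]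
  refine measure_mono fun ω hω => ?_
  have hω' : wordVal d (fun i : Fin k => ω i) = j := hω
  have e := proj_mul_pow hd k ω
  rw [hω'] at e
  have h1 := proj_nonneg (d := d) fun i => ω (i + k)
  have h2 := proj_le_xi hd fun i => ω (i + k)
  exact hj _ (by linarith) (by linarith)

lemma selfSimilar_le_sum (hd : 3 ≤ d) {k : ℕ} {E : Set ℝ} (hE : MeasurableSet E) (J : Finset ℤ)
    (hJ : ∀ x ∈ E, ∀ j : ℤ, (j : ℝ) ≤ x * (d : ℝ) ^ k → x * (d : ℝ) ^ k ≤ j + xi d m → j ∈ J) :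
    selfSimilar d p E ≤ ENNReal.ofReal (∑ j ∈ J, mass d p k j) := by
  rw [selfSimilar, Measure.map_apply (measurable_proj hd) hE,
    ENNReal.ofReal_sum_of_nonneg fun _ _ => mass_nonneg _ _]
  simp_rw [← bernoulli_wordVal]
  refine (measure_mono fun ω hω => ?_).trans (measure_biUnion_finset_le J _)
  have e := proj_mul_pow hd k ω
  have h1 := proj_nonneg (d := d) fun i => ω (i + k)
  have h2 := proj_le_xi hd fun i => ω (i + k)
  simp only [Set.mem_iUnion, Set.mem_ofPred_eq, exists_prop, exists_eq_right']
  exact hJ _ hω _ (by linarith) (by linarith)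

lemma selfSimilar_restrict_full (hd : 3 ≤ d) :
    (selfSimilar d p).restrict (Set.Icc 0 (xi d m)) = selfSimilar d p := by
  refine Measure.restrict_eq_self_of_ae_mem ?_
  exact (ae_map_iff (p := fun x => x ∈ Set.Icc 0 (xi d m)) (measurable_proj hd).aemeasurable
    measurableSet_Icc).2 (.of_forall fun ω => ⟨proj_nonneg ω, proj_le_xi hd ω⟩)

/-! ### Measures of balls -/

/-- The constant comparing the measure of a ball to the mass of an integer of level `k`. -/
def ballConst (d : ℕ) {m : ℕ} (p : PMF (Fin (m + 1))) (k : ℕ) : ℝ :=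
  (6 * d + 11) * ratioBound p k ^ (3 * d + 5)

lemma one_le_ballConst (h : Admissible d m p) (k : ℕ) : 1 ≤ ballConst d p k := by
  have h1 : (1 : ℝ) ≤ ratioBound p k ^ (3 * d + 5) := one_le_pow₀ (one_le_ratioBound h k)
  have h2 : (1 : ℝ) ≤ 6 * d + 11 := by
    have : (0 : ℝ) ≤ d := by positivity
    linarith
  exact one_le_mul_of_one_le_of_one_le h2 h1

section Balls

variable {u v : ℝ} {k : ℕ}

/-- Near every point of [u, v], the endpoints included, there is a cell lying entirely in [u, v]:
the first one to the right of x, or the last one that fits. -/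
lemma exists_mem_window (h : Admissible d m p) (hk : 3 ≤ (v - u) * (d : ℝ) ^ k) {x : ℝ}
    (hx : x ∈ Set.Icc u v) : ∃ j ∈ window d m u v k,
      x * (d : ℝ) ^ k - 3 ≤ j ∧ j + xi d m ≤ x * (d : ℝ) ^ k + 3 := by
  have hxi := xi_bounds h
  have hd := one_le_pow_real h k
  have hux : u * (d : ℝ) ^ k ≤ x * (d : ℝ) ^ k := mul_le_mul_of_nonneg_right hx.1 (by linarith)
  have hxv : x * (d : ℝ) ^ k ≤ v * (d : ℝ) ^ k := mul_le_mul_of_nonneg_right hx.2 (by linarith)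
  simp only [mem_window]
  rcases le_or_gt (x * (d : ℝ) ^ k + xi d m + 1) (v * (d : ℝ) ^ k) with hle | hlt
  · have h1 := Int.le_ceil (x * (d : ℝ) ^ k)
    have h2 := Int.ceil_lt_add_one (x * (d : ℝ) ^ k)
    exact ⟨⌈x * (d : ℝ) ^ k⌉, ⟨by linarith, by linarith⟩, by linarith, by linarith⟩
  · have h1 := Int.floor_le (v * (d : ℝ) ^ k - xi d m)
    have h2 := Int.lt_floor_add_one (v * (d : ℝ) ^ k - xi d m)
    exact ⟨⌊v * (d : ℝ) ^ k - xi d m⌋, ⟨by linarith, by linarith⟩, by linarith, by linarith⟩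

/-- The ball contains the cell of j, which survives the restriction because j is in the window.
Conversely, the ball meets only boundedly many cells, all with masses comparable to that of j. -/
lemma closedBall_measure_bounds (h : Admissible d m p) (hu : 0 ≤ u) (hv : v ≤ xi d m) {r x : ℝ}
    (hr : 3 ≤ r * (d : ℝ) ^ k) (hr' : r * (d : ℝ) ^ k ≤ 3 * d) {j : ℤ}
    (hj : j ∈ window d m u v k) (hj1 : x * (d : ℝ) ^ k - 3 ≤ j)
    (hj2 : j + xi d m ≤ x * (d : ℝ) ^ k + 3) :
    ENNReal.ofReal (mass d p k j) ≤
        (selfSimilar d p).restrict (Set.Icc u v) (Metric.closedBall x r) ∧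
      (selfSimilar d p).restrict (Set.Icc u v) (Metric.closedBall x r) ≤
        ENNReal.ofReal (ballConst d p k * mass d p k j) := by
  have hd := one_le_pow_real h k
  have hd0 : (0 : ℝ) < (d : ℝ) ^ k := by linarith
  have hxi := xi_bounds h
  obtain ⟨w1, w2⟩ := mem_window.1 hj
  obtain ⟨b1, b2⟩ := window_bounds h hu hv hj
  constructor
  · rw [Measure.restrict_apply Metric.isClosed_closedBall.measurableSet]
    refine mass_le_selfSimilar h.three_le
      (Metric.isClosed_closedBall.measurableSet.inter measurableSet_Icc) fun y hy1 hy2 => ⟨?_, ?_, ?_⟩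
    · rw [Real.closedBall_eq_Icc]
      constructor
      · refine le_of_mul_le_mul_right ?_ hd0
        rw [sub_mul]
        linarith
      · refine le_of_mul_le_mul_right ?_ hd0
        rw [add_mul]
        linarith
    · exact le_of_mul_le_mul_right (by linarith) hd0
    · exact le_of_mul_le_mul_right (by linarith) hd0
  · refine (Measure.restrict_apply_le _ _).trans ?_
    -- The range 3d + 5 adds the scaled radius 3d, the distance 3 from x to the cell, and the cell
    -- length ξ < 2.
    refine (selfSimilar_le_sum h.three_le (k := k) Metric.isClosed_closedBall.measurableSet
      (Finset.Icc (j - (3 * d + 5 : ℕ)) (j + (3 * d + 5 : ℕ))) ?_).trans ?_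
    · intro y hy i hi1 hi2
      rw [Real.closedBall_eq_Icc] at hy
      have y1 := mul_le_mul_of_nonneg_right hy.1 hd0.le
      have y2 := mul_le_mul_of_nonneg_right hy.2 hd0.le
      rw [sub_mul] at y1
      rw [add_mul] at y2
      have i1 : ((j - (3 * d + 5 : ℕ) : ℤ) : ℝ) ≤ i := by push_cast; linarith
      have i2 : (i : ℝ) ≤ ((j + (3 * d + 5 : ℕ) : ℤ) : ℝ) := by push_cast; linarith
      exact Finset.mem_Icc.2 ⟨by exact_mod_cast i1, by exact_mod_cast i2⟩
    · refine ENNReal.ofReal_le_ofReal ?_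
      calc ∑ i ∈ Finset.Icc (j - (3 * d + 5 : ℕ)) (j + (3 * d + 5 : ℕ)), mass d p k i
          ≤ ∑ _i ∈ Finset.Icc (j - (3 * d + 5 : ℕ)) (j + (3 * d + 5 : ℕ)),
              ratioBound p k ^ (3 * d + 5) * mass d p k j := by
            refine Finset.sum_le_sum fun i hi => mass_le_of_dist h k _ b1 b2 ?_
            obtain ⟨i1, i2⟩ := Finset.mem_Icc.1 hi
            rw [abs_le]
            constructor <;> linarith
        _ = ballConst d p k * mass d p k j := by
            rw [Finset.sum_const, Int.card_Icc, nsmul_eq_mul, ballConst, mul_assoc]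
            congr 1
            have : (j + (3 * d + 5 : ℕ) + 1 - (j - (3 * d + 5 : ℕ))).toNat = 6 * d + 11 := by omega
            rw [this]
            push_cast
            ring

lemma support_restrict_selfSimilar (h : Admissible d m p) (hu : 0 ≤ u) (huv : u < v)
    (hv : v ≤ xi d m) :
    ((selfSimilar d p).restrict (Set.Icc u v)).support = Set.Icc u v := by
  apply Set.Subset.antisymm
  · exact Measure.support_subset_of_isClosed isClosed_Icc (ae_restrict_mem measurableSet_Icc)
  · intro x hx
    rw [Measure.mem_support_iff_forall]
    intro U hU
    obtain ⟨ε, hε, hεU⟩ := Metric.nhds_basis_closedBall.mem_iff.1 hU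
    have hd1 : (1 : ℝ) < d := by have := h.three_le; exact_mod_cast (by omega : 1 < d)
    have huv' : 0 < v - u := by linarith
    obtain ⟨k, hk⟩ := pow_unbounded_of_one_lt (max (3 / ε) (3 / (v - u))) hd1
    have hd0 : (0 : ℝ) < (d : ℝ) ^ k := by positivity
    have hk1 : 3 / ε < (d : ℝ) ^ k := (le_max_left _ _).trans_lt hk
    have hk2 : 3 / (v - u) < (d : ℝ) ^ k := (le_max_right _ _).trans_lt hk
    rw [div_lt_iff₀ hε] at hk1
    rw [div_lt_iff₀ huv'] at hk2
    obtain ⟨j, hj, hj1, hj2⟩ := exists_mem_window h (by linarith : 3 ≤ (v - u) * (d : ℝ) ^ k) hx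
    obtain ⟨b1, b2⟩ := window_bounds h hu hv hj
    have e : 3 / (d : ℝ) ^ k * (d : ℝ) ^ k = 3 := by field_simp
    have hb := (closedBall_measure_bounds h hu hv (r := 3 / (d : ℝ) ^ k) e.ge
      (by rw [e]; linarith) hj hj1 hj2).1
    refine lt_of_lt_of_le (lt_of_lt_of_le (ENNReal.ofReal_pos.2 (mass_pos h b1 b2)) hb)
      (measure_mono ((Metric.closedBall_subset_closedBall ?_).trans hεU))
    rw [div_le_iff₀ hd0]
    linarith

/-! ### Packing sums -/

lemma closedBall_rpow_comparable (h : Admissible d m p) (hu : 0 ≤ u) (hv : v ≤ xi d m) {r x : ℝ}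
    (hr : 3 ≤ r * (d : ℝ) ^ k) (hr' : r * (d : ℝ) ^ k ≤ 3 * d) {j : ℤ}
    (hj : j ∈ window d m u v k) (hj1 : x * (d : ℝ) ^ k - 3 ≤ j)
    (hj2 : j + xi d m ≤ x * (d : ℝ) ^ k + 3) (q : ℝ) :
    (selfSimilar d p).restrict (Set.Icc u v) (Metric.closedBall x r) ^ q ≤
        ENNReal.ofReal (ballConst d p k ^ |q| * mass d p k j ^ q) ∧
      ENNReal.ofReal (mass d p k j ^ q) ≤ ENNReal.ofReal (ballConst d p k ^ |q|) *
        (selfSimilar d p).restrict (Set.Icc u v) (Metric.closedBall x r) ^ q := by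
  obtain ⟨h1, h2⟩ := closedBall_measure_bounds h hu hv hr hr' hj hj1 hj2
  obtain ⟨b1, b2⟩ := window_bounds h hu hv hj
  have hpos := mass_pos h b1 b2
  have hE := one_le_ballConst h k
  set M := (selfSimilar d p).restrict (Set.Icc u v) (Metric.closedBall x r) with hM
  have hfin : M ≠ ∞ := (h2.trans_lt ENNReal.ofReal_lt_top).ne
  obtain ⟨a, ha0, ha⟩ : ∃ a : ℝ, 0 ≤ a ∧ M = ENNReal.ofReal a :=
    ⟨M.toReal, ENNReal.toReal_nonneg, (ENNReal.ofReal_toReal hfin).symm⟩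
  rw [ha] at h1 h2 ⊢
  rw [ENNReal.ofReal_le_ofReal_iff ha0] at h1
  rw [ENNReal.ofReal_le_ofReal_iff (by positivity)] at h2
  have ha' : 0 < a := hpos.trans_le h1
  rw [ENNReal.ofReal_rpow_of_pos ha', ← ENNReal.ofReal_mul (by positivity)]
  have h3 : mass d p k j ≤ ballConst d p k * a := h1.trans (le_mul_of_one_le_left ha'.le hE)
  exact ⟨ENNReal.ofReal_le_ofReal (rpow_le_of_comparable q ha' hpos hE h2 h3),
    ENNReal.ofReal_le_ofReal (rpow_le_of_comparable q hpos ha' hE h3 h2)⟩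

lemma two_mul_lt_of_disjoint_closedBall {x y r : ℝ}
    (hxy : Disjoint (Metric.closedBall x r) (Metric.closedBall y r)) : 2 * r < |x - y| := by
  by_contra! hle
  rw [abs_le] at hle
  rw [Real.closedBall_eq_Icc, Real.closedBall_eq_Icc, Set.disjoint_left] at hxy
  exact hxy (a := (x + y) / 2) ⟨by linarith, by linarith⟩ ⟨by linarith, by linarith⟩

lemma disjoint_closedBall_of_lt {x y r : ℝ} (hxy : 2 * r < |x - y|) :
    Disjoint (Metric.closedBall x r) (Metric.closedBall y r) := by
  refine Metric.closedBall_disjoint_closedBall ?_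
  rw [Real.dist_eq]
  linarith

/-- Each centre is assigned a nearby cell. Centres sharing a cell are at distance at most 6 / d^k ≤
2r, so disjoint balls receive distinct cells. -/
lemma packingSum_le (h : Admissible d m p) (hu : 0 ≤ u) (huv : u < v) (hv : v ≤ xi d m)
    (hk : 3 ≤ (v - u) * (d : ℝ) ^ k) {r : ℝ} (hr : 3 ≤ r * (d : ℝ) ^ k)
    (hr' : r * (d : ℝ) ^ k ≤ 3 * d) (q : ℝ) :
    packingSum ((selfSimilar d p).restrict (Set.Icc u v)) r q ≤
      ENNReal.ofReal (ballConst d p k ^ |q| * windowSum d p u v k q) := by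
  have hd := one_le_pow_real h k
  have hd0 : (0 : ℝ) < (d : ℝ) ^ k := by linarith
  have hxi := xi_bounds h
  have hE := one_le_ballConst h k
  rw [packingSum, support_restrict_selfSimilar h hu huv hv]
  refine iSup_le fun t => iSup_le fun ht => iSup_le fun hdisj => ?_
  have hex : ∀ x : ℝ, ∃ j : ℤ, x ∈ t → j ∈ window d m u v k ∧
      x * (d : ℝ) ^ k - 3 ≤ j ∧ j + xi d m ≤ x * (d : ℝ) ^ k + 3 := by
    intro x
    by_cases hx : x ∈ t
    · obtain ⟨j, hj⟩ := exists_mem_window h hk (ht hx)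
      exact ⟨j, fun _ => hj⟩
    · exact ⟨0, fun hx' => absurd hx' hx⟩
  choose e he using hex
  calc ∑ x ∈ t, (selfSimilar d p).restrict (Set.Icc u v) (Metric.closedBall x r) ^ q
      ≤ ∑ x ∈ t, ENNReal.ofReal (ballConst d p k ^ |q| * mass d p k (e x) ^ q) :=
        Finset.sum_le_sum fun x hx => (closedBall_rpow_comparable h hu hv hr hr' (he x hx).1
          (he x hx).2.1 (he x hx).2.2 q).1
    _ = ENNReal.ofReal (∑ x ∈ t, ballConst d p k ^ |q| * mass d p k (e x) ^ q) :=
        (ENNReal.ofReal_sum_of_nonneg fun x _ =>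
          mul_nonneg (by positivity) (mass_rpow_nonneg _ _ _)).symm
    _ ≤ ENNReal.ofReal (ballConst d p k ^ |q| * windowSum d p u v k q) := by
        refine ENNReal.ofReal_le_ofReal ?_
        rw [windowSum, Finset.mul_sum]
        refine sum_le_sum_of_injOn e _ _ (fun x hx => (he x hx).1) ?_ (fun _ _ => le_rfl)
          fun j _ => mul_nonneg (by positivity) (mass_rpow_nonneg _ _ _)
        intro x hx y hy hxy
        by_contra hne
        have hlt := two_mul_lt_of_disjoint_closedBall (hdisj hx hy hne)
        obtain ⟨-, x1, x2⟩ := he x hx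
        obtain ⟨-, y1, y2⟩ := he y hy
        rw [hxy] at x1 x2
        have h1 : |x - y| * (d : ℝ) ^ k ≤ 6 := by
          rw [← abs_of_pos hd0, ← abs_mul, abs_le, sub_mul]
          constructor <;> linarith
        nlinarith

lemma exists_class_sum_ge {S : Finset ℤ} {f : ℤ → ℝ} {R : ℕ} (hR : 0 < R) :
    ∃ c : ℤ, ∑ j ∈ S, f j ≤ R * ∑ j ∈ S with j % R = c, f j := by
  have hmaps : ∀ j ∈ S, j % (R : ℤ) ∈ Finset.Ico (0 : ℤ) R := fun j _ =>
    Finset.mem_Ico.2 ⟨Int.emod_nonneg _ (by omega), Int.emod_lt_of_pos _ (by omega)⟩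
  have hsum := Finset.sum_fiberwise_of_maps_to hmaps f
  by_contra! hcon
  have hlt : ∑ c ∈ Finset.Ico (0 : ℤ) R, (R : ℝ) * ∑ j ∈ S with j % (R : ℤ) = c, f j <
      ∑ _c ∈ Finset.Ico (0 : ℤ) R, ∑ j ∈ S, f j :=
    Finset.sum_lt_sum_of_nonempty ⟨0, Finset.mem_Ico.2 ⟨le_rfl, by omega⟩⟩ fun c _ => hcon c
  rw [← Finset.mul_sum, hsum, Finset.sum_const, Int.card_Ico, sub_zero, Int.toNat_natCast,
    nsmul_eq_mul] at hlt
  exact lt_irrefl _ hlt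

/-- By pigeonhole some residue class modulo 6d + 1 carries its share of the window sum. Its points
are more than 2r apart after scaling, because 2r d^k ≤ 6d, and so they centre a packing. -/
lemma le_packingSum (h : Admissible d m p) (hu : 0 ≤ u) (huv : u < v) (hv : v ≤ xi d m)
    {r : ℝ} (hr : 3 ≤ r * (d : ℝ) ^ k) (hr' : r * (d : ℝ) ^ k ≤ 3 * d) (q : ℝ) :
    ENNReal.ofReal (windowSum d p u v k q) ≤
      ENNReal.ofReal ((6 * d + 1) * ballConst d p k ^ |q|) *
        packingSum ((selfSimilar d p).restrict (Set.Icc u v)) r q := by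
  have hd := one_le_pow_real h k
  have hd0 : (0 : ℝ) < (d : ℝ) ^ k := by linarith
  have hxi := xi_bounds h
  have hE := one_le_ballConst h k
  obtain ⟨c, hc⟩ := exists_class_sum_ge (S := window d m u v k) (f := fun j => mass d p k j ^ q)
    (R := 6 * d + 1) (by omega)
  set S := (window d m u v k).filter (fun j => j % ((6 * d + 1 : ℕ) : ℤ) = c) with hS
  set e : ℤ → ℝ := fun j => (j : ℝ) / (d : ℝ) ^ k with he
  have hek : ∀ j, e j * (d : ℝ) ^ k = j := fun j => by simp only [he]; field_simp
  have hinj : Function.Injective e := by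
    intro i j hij
    have : (i : ℝ) = j := by rw [← hek i, ← hek j, hij]
    exact_mod_cast this
  have hsub : ((S.image e : Finset ℝ) : Set ℝ) ⊆
      ((selfSimilar d p).restrict (Set.Icc u v)).support := by
    rw [support_restrict_selfSimilar h hu huv hv]
    intro x hx
    obtain ⟨j, hj, rfl⟩ := Finset.mem_image.1 (Finset.mem_coe.1 hx)
    obtain ⟨w1, w2⟩ := mem_window.1 (Finset.mem_filter.1 hj).1
    rw [← hek j] at w1 w2
    exact ⟨le_of_mul_le_mul_right w1 hd0, le_of_mul_le_mul_right (by linarith) hd0⟩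
  have hdisj : ((S.image e : Finset ℝ) : Set ℝ).PairwiseDisjoint
      fun x => Metric.closedBall x r := by
    intro x hx y hy hne
    obtain ⟨i, hi, rfl⟩ := Finset.mem_image.1 (Finset.mem_coe.1 hx)
    obtain ⟨j, hj, rfl⟩ := Finset.mem_image.1 (Finset.mem_coe.1 hy)
    refine disjoint_closedBall_of_lt ?_
    have hij : i ≠ j := fun hij => hne (by rw [hij])
    have hdvd : ((6 * d + 1 : ℕ) : ℤ) ∣ i - j :=
      Int.ModEq.dvd ((Finset.mem_filter.1 hj).2.trans (Finset.mem_filter.1 hi).2.symm)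
    have habs : ((6 * d + 1 : ℕ) : ℤ) ≤ |i - j| :=
      Int.le_of_dvd (abs_pos.2 (sub_ne_zero.2 hij)) ((dvd_abs _ _).2 hdvd)
    have habs' : (6 * d + 1 : ℝ) ≤ |(i : ℝ) - j| := by exact_mod_cast habs
    refine lt_of_mul_lt_mul_right (a := (d : ℝ) ^ k) ?_ hd0.le
    have : |e i - e j| * (d : ℝ) ^ k = |(i : ℝ) - j| := by
      rw [← abs_of_pos hd0, ← abs_mul, sub_mul, hek, hek]
    rw [this]
    linarith
  have hpack : ∑ x ∈ S.image e,
      (selfSimilar d p).restrict (Set.Icc u v) (Metric.closedBall x r) ^ q ≤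
        packingSum ((selfSimilar d p).restrict (Set.Icc u v)) r q :=
    le_iSup_of_le (S.image e) (le_iSup_of_le hsub (le_iSup_of_le hdisj le_rfl))
  rw [Finset.sum_image fun _ _ _ _ hxy => hinj hxy] at hpack
  have hE0 : 0 ≤ ballConst d p k := by linarith
  calc ENNReal.ofReal (windowSum d p u v k q)
      ≤ ENNReal.ofReal ((6 * d + 1) * ∑ j ∈ S, mass d p k j ^ q) := by
        refine ENNReal.ofReal_le_ofReal (hc.trans_eq ?_)
        push_cast
        rfl
    _ = ENNReal.ofReal (6 * d + 1) * ∑ j ∈ S, ENNReal.ofReal (mass d p k j ^ q) := by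
        rw [ENNReal.ofReal_mul (by positivity),
          ENNReal.ofReal_sum_of_nonneg fun j _ => mass_rpow_nonneg _ _ _]
    _ ≤ ENNReal.ofReal (6 * d + 1) * ∑ j ∈ S, ENNReal.ofReal (ballConst d p k ^ |q|) *
          (selfSimilar d p).restrict (Set.Icc u v) (Metric.closedBall (e j) r) ^ q := by
        refine mul_le_mul_right (Finset.sum_le_sum fun j hj => ?_) _
        refine (closedBall_rpow_comparable h hu hv hr hr' (Finset.mem_filter.1 hj).1 ?_ ?_ q).2
        · rw [hek]; linarith
        · rw [hek]; linarith
    _ ≤ _ := by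
        rw [← Finset.mul_sum, ENNReal.ofReal_mul (by positivity), mul_assoc]
        exact mul_le_mul_right (mul_le_mul_right hpack _) _

/-! ### The spectrum from the growth of window sums -/

lemma tendsto_log_ballConst (h : Admissible d m p) (c q : ℝ) :
    Tendsto (fun n : ℕ => (c + |q| * Real.log (ballConst d p n)) / n) atTop (𝓝 0) := by
  have h1 := (tendsto_log_ratioBound h).const_mul (|q| * ((3 * d + 5 : ℕ) : ℝ))
  have h2 := tendsto_const_div_nat (c + |q| * Real.log (6 * d + 11))
  have h3 := h1.add h2
  rw [mul_zero, add_zero] at h3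
  refine h3.congr fun n => ?_
  have hD := one_le_ratioBound h n
  rw [ballConst, Real.log_mul (by positivity) (by positivity), Real.log_pow]
  ring

lemma log_base_pos (h : Admissible d m p) : 0 < Real.log d :=
  Real.log_pos (by have := h.three_le; exact_mod_cast (by omega : 1 < d))

/-- The level at which balls of radius `r` are compared with masses. -/
def scale (d : ℕ) (r : ℝ) : ℕ := ⌈Real.log (3 / r) / Real.log d⌉₊

lemma scale_spec (h : Admissible d m p) {r : ℝ} (hr0 : 0 < r) (hr : r < 3) :
    3 ≤ r * (d : ℝ) ^ scale d r ∧ r * (d : ℝ) ^ scale d r ≤ 3 * d := by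
  have hlog := log_base_pos h
  have hd0 : (0 : ℝ) < d := by have := h.three_le; exact_mod_cast (by omega : 0 < d)
  have h3r : 0 < Real.log (3 / r) := Real.log_pos ((one_lt_div hr0).2 hr)
  have h1 := Nat.le_ceil (Real.log (3 / r) / Real.log d)
  have h2 := Nat.ceil_lt_add_one (div_nonneg h3r.le hlog.le)
  change _ ≤ (scale d r : ℝ) at h1
  change (scale d r : ℝ) < _ at h2
  rw [div_le_iff₀ hlog] at h1
  rw [← sub_lt_iff_lt_add, lt_div_iff₀ hlog] at h2
  have hpow : (d : ℝ) ^ scale d r = Real.exp (scale d r * Real.log d) := by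
    rw [Real.exp_nat_mul, Real.exp_log hd0]
  have e1 : 3 / r ≤ (d : ℝ) ^ scale d r := by
    rw [hpow, ← Real.log_le_iff_le_exp (by positivity)]
    exact h1
  have e2 : (d : ℝ) ^ scale d r ≤ 3 / r * d := by
    rw [hpow, ← Real.le_log_iff_exp_le (by positivity), Real.log_mul (by positivity) hd0.ne']
    linarith
  rw [div_le_iff₀ hr0] at e1
  rw [div_mul_eq_mul_div, le_div_iff₀ hr0] at e2
  constructor <;> linarith

lemma tendsto_scale (h : Admissible d m p) : Tendsto (scale d) (𝓝[>] 0) atTop := by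
  have hlog := log_base_pos h
  refine tendsto_nat_ceil_atTop.comp ?_
  refine Tendsto.atTop_div_const hlog (Real.tendsto_log_atTop.comp ?_)
  exact (tendsto_inv_nhdsGT_zero.const_mul_atTop (by norm_num : (0 : ℝ) < 3)).congr fun r =>
    (div_eq_mul_inv _ _).symm

/-- With k = `scale d r`, log r is -k log d up to a bounded error, and the packing sum is the window
sum of level k up to subexponential factors; the quotient tends to L / (-log d) = δ L. -/
lemma tendsto_packingSum (h : Admissible d m p) (hu : 0 ≤ u) (huv : u < v) (hv : v ≤ xi d m)
    {q L : ℝ}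
    (hL : Tendsto (fun n : ℕ => Real.log (windowSum d p u v n q) / n) atTop (𝓝 L)) :
    Tendsto (fun r : ℝ =>
      ENNReal.log (packingSum ((selfSimilar d p).restrict (Set.Icc u v)) r q) /
        ((Real.log r : ℝ) : EReal)) (𝓝[>] (0 : ℝ)) (𝓝 ((delta d * L : ℝ) : EReal)) := by
  have hlog := log_base_pos h
  have hd1 : (1 : ℝ) < d := by have := h.three_le; exact_mod_cast (by omega : 1 < d)
  have hd0 : (0 : ℝ) < d := by linarith
  have hscale := tendsto_scale h
  set F : ℝ → ℝ := fun r =>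
    (packingSum ((selfSimilar d p).restrict (Set.Icc u v)) r q).toReal with hF
  have hsmall : ∀ᶠ r : ℝ in 𝓝[>] 0, 0 < r ∧ r < 3 := by
    filter_upwards [Ioo_mem_nhdsGT (by norm_num : (0 : ℝ) < 3)] with r hr using hr
  have hlarge : ∀ᶠ n : ℕ in atTop, 3 ≤ (v - u) * (d : ℝ) ^ n := by
    have := (tendsto_pow_atTop_atTop_of_one_lt hd1).const_mul_atTop (sub_pos.2 huv)
    exact this.eventually_ge_atTop 3
  have key : ∀ᶠ r : ℝ in 𝓝[>] 0,
      ENNReal.log (packingSum ((selfSimilar d p).restrict (Set.Icc u v)) r q) =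
        ((Real.log (F r) : ℝ) : EReal) ∧
      |Real.log (F r) - Real.log (windowSum d p u v (scale d r) q)| ≤
        Real.log (6 * d + 1) + |q| * Real.log (ballConst d p (scale d r)) := by
    filter_upwards [hsmall, hscale.eventually hlarge] with r hr hk
    obtain ⟨s1, s2⟩ := scale_spec h hr.1 hr.2
    have hE := one_le_ballConst h (scale d r)
    have hE' := one_le_rpow_abs hE q
    have up := packingSum_le h hu huv hv hk s1 s2 q
    have lo := le_packingSum h hu huv hv s1 s2 q
    obtain ⟨j, hj, -⟩ := exists_mem_window h hk (Set.left_mem_Icc.2 huv.le)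
    have hW := windowSum_pos h hu hv ⟨j, hj⟩ q
    set X := packingSum ((selfSimilar d p).restrict (Set.Icc u v)) r q with hX
    have hfin : X ≠ ∞ := (up.trans_lt ENNReal.ofReal_lt_top).ne
    have hFr : F r = X.toReal := rfl
    have hXF : X = ENNReal.ofReal (F r) := (ENNReal.ofReal_toReal hfin).symm
    have hF0 : 0 ≤ F r := ENNReal.toReal_nonneg
    rw [hXF] at up lo
    rw [ENNReal.ofReal_le_ofReal_iff (by positivity)] at up
    rw [← ENNReal.ofReal_mul (by positivity),
      ENNReal.ofReal_le_ofReal_iff (by positivity)] at lo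
    have hFpos : 0 < F r := by
      rcases hF0.eq_or_lt with h0 | h0
      · rw [← h0, mul_zero] at lo
        linarith
      · exact h0
    refine ⟨?_, ?_⟩
    · rw [hXF, ENNReal.log_ofReal_of_pos hFpos]
    · have hC : Real.log (6 * d + 1) + |q| * Real.log (ballConst d p (scale d r)) =
          Real.log ((6 * d + 1) * ballConst d p (scale d r) ^ |q|) := by
        rw [Real.log_mul (by positivity) (by positivity), Real.log_rpow (by linarith)]
      rw [hC]
      refine abs_log_sub_log_le hFpos hW (by positivity) (up.trans ?_) lo
      refine mul_le_mul_of_nonneg_right ?_ hW.le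
      nlinarith
  have hnum : Tendsto (fun r => Real.log (F r) / (scale d r : ℝ)) (𝓝[>] 0) (𝓝 L) := by
    have h1 := hL.comp hscale
    have h2 : Tendsto (fun r => (Real.log (F r) -
        Real.log (windowSum d p u v (scale d r) q)) / (scale d r : ℝ)) (𝓝[>] 0) (𝓝 0) := by
      refine squeeze_zero_norm' ?_
        ((tendsto_log_ballConst h (Real.log (6 * d + 1)) q).comp hscale)
      filter_upwards [key] with r hr
      rw [Real.norm_eq_abs, abs_div, Nat.abs_cast]
      simp only [Function.comp_apply]
      gcongr
      exact hr.2
    have h3 := h1.add h2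
    rw [add_zero] at h3
    refine h3.congr fun r => ?_
    simp only [Function.comp_apply]
    ring
  have hden : Tendsto (fun r => Real.log r / (scale d r : ℝ)) (𝓝[>] 0) (𝓝 (-Real.log d)) := by
    have h2 : Tendsto (fun r => (Real.log r + scale d r * Real.log d) / (scale d r : ℝ))
        (𝓝[>] 0) (𝓝 0) := by
      refine squeeze_zero_norm' ?_ ((tendsto_const_div_nat (Real.log (3 * d))).comp hscale)
      filter_upwards [hsmall] with r hr
      obtain ⟨s1, s2⟩ := scale_spec h hr.1 hr.2
      rw [Real.norm_eq_abs, abs_div, Nat.abs_cast]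
      simp only [Function.comp_apply]
      gcongr
      have e : Real.log (r * (d : ℝ) ^ scale d r) = Real.log r + scale d r * Real.log d := by
        rw [Real.log_mul hr.1.ne' (by positivity), Real.log_pow]
      rw [← e, abs_of_nonneg (Real.log_nonneg (by linarith))]
      exact Real.log_le_log (by linarith) s2
    have h3 := h2.sub_const (Real.log d)
    rw [zero_sub] at h3
    refine h3.congr' ?_
    filter_upwards [hscale.eventually (eventually_gt_atTop 0)] with r hr
    have : (scale d r : ℝ) ≠ 0 := by exact_mod_cast hr.ne'
    field_simp
    ring
  have hquot : Tendsto (fun r => Real.log (F r) / Real.log r) (𝓝[>] 0) (𝓝 (delta d * L)) := by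
    have h1 := hnum.div hden (neg_ne_zero.2 hlog.ne')
    have h2 : L / -Real.log d = delta d * L := by
      rw [delta]
      field_simp
    rw [h2] at h1
    refine h1.congr' ?_
    filter_upwards [hscale.eventually (eventually_gt_atTop 0)] with r hr
    have : (scale d r : ℝ) ≠ 0 := by exact_mod_cast hr.ne'
    simp only [Pi.div_apply]
    rw [div_div_div_cancel_right₀ this]
  refine ((continuous_coe_real_ereal.tendsto _).comp hquot).congr' ?_
  filter_upwards [key] with r hr
  rw [hr.1, Function.comp_apply, EReal.coe_div]

end Balls

/-! ### Spectral radius and row sums -/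

section SpectralRadius

variable {ι : Type} [Fintype ι] [DecidableEq ι]

attribute [local instance] Matrix.linftyOpNormedRing Matrix.linftyOpNormedAlgebra

lemma row_sum_le_norm (A : Matrix ι ι ℝ) (i : ι) :
    ∑ j, |A i j| ≤ ‖A.map (fun x : ℝ => (x : ℂ))‖ := by
  rw [Matrix.linfty_opNorm_def]
  have h1 : ∑ j, |A i j| =
      ((∑ j, ‖A.map (fun x : ℝ => (x : ℂ)) i j‖₊ : NNReal) : ℝ) := by
    push_cast
    refine Finset.sum_congr rfl fun j _ => ?_
    simp
  rw [h1]
  exact NNReal.coe_le_coe.2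
    (Finset.le_sup (f := fun i => ∑ j, ‖A.map (fun x : ℝ => (x : ℂ)) i j‖₊) (Finset.mem_univ i))

lemma rho_le_of_row_sum_le [Nonempty ι] (A : Matrix ι ι ℝ) {c : ℝ} (hc : 0 ≤ c)
    (hA : ∀ i, ∑ j, |A i j| ≤ c) : rho A ≤ c := by
  have h1 : ‖A.map (fun x : ℝ => (x : ℂ))‖ ≤ c := by
    rw [Matrix.linfty_opNorm_def]
    have : (Finset.univ.sup fun i => ∑ j, ‖A.map (fun x : ℝ => (x : ℂ)) i j‖₊) ≤ c.toNNReal := by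
      refine Finset.sup_le fun i _ => ?_
      rw [← NNReal.coe_le_coe, Real.coe_toNNReal c hc]
      push_cast
      simpa using hA i
    have h2 := NNReal.coe_le_coe.2 this
    rwa [Real.coe_toNNReal c hc] at h2
  have h2 := spectrum.spectralRadius_le_nnnorm (𝕜 := ℂ) (A.map (fun x : ℝ => (x : ℂ)))
  unfold rho
  refine (ENNReal.toReal_mono ENNReal.coe_ne_top h2).trans ?_
  simpa using h1

/-- Gelfand's formula for the maximal row sum norm; row sums are what can be compared with masses.
-/
lemma exists_tendsto_rho (A : Matrix ι ι ℝ) : ∃ N : ℕ → ℝ,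
    (∀ j i, ∑ l, |(A ^ j) i l| ≤ N j) ∧
      Tendsto (fun j : ℕ => N j ^ (1 / (j : ℝ))) atTop (𝓝 (rho A)) := by
  refine ⟨fun j => ‖(A.map (fun x : ℝ => (x : ℂ))) ^ j‖, fun j i => ?_, ?_⟩
  · have e : (A.map (fun x : ℝ => (x : ℂ))) ^ j = (A ^ j).map (fun x : ℝ => (x : ℂ)) :=
      (map_pow (Complex.ofRealHom.mapMatrix (m := ι)) A j).symm
    simp only [e]
    exact row_sum_le_norm _ i
  · have h1 := spectrum.pow_norm_pow_one_div_tendsto_nhds_spectralRadius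
      (A.map (fun x : ℝ => (x : ℂ)))
    have h2 : spectralRadius ℂ (A.map (fun x : ℝ => (x : ℂ))) ≠ ∞ := by
      have := spectrum.spectralRadius_le_pow_nnnorm_pow_one_div ℂ
        (A.map (fun x : ℝ => (x : ℂ))) 0
      refine (this.trans_lt ?_).ne
      simp [ENNReal.mul_lt_top_iff]
    refine ((ENNReal.tendsto_toReal h2).comp h1).congr fun j => ?_
    rw [Function.comp_apply, ENNReal.toReal_ofReal (by positivity)]

end SpectralRadius

lemma rho_nonneg {ι : Type} [Fintype ι] [DecidableEq ι] (A : Matrix ι ι ℝ) : 0 ≤ rho A :=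
  ENNReal.toReal_nonneg

/-! ### Transfer matrices -/

/-- The product of the transfer matrices of the letters of a list. -/
def transferList (d : ℕ) {m : ℕ} (p : PMF (Fin (m + 1))) (L : List (Fin (m + 1))) :
    Matrix (MatIdx d m) (MatIdx d m) ℝ :=
  ((L.map (transfer d p)).reverse).prod

/-- The integer value of a list of digits. -/
def listVal (d : ℕ) {m : ℕ} (L : List (Fin (m + 1))) : ℤ :=
  L.foldl (fun a i => (d : ℤ) * a + (i : ℕ)) 0

lemma transferWord_eq {k : ℕ} (σ : Fin k → Fin (m + 1)) :
    transferWord d p σ = transferList d p (List.ofFn σ) := by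
  rw [transferWord, transferList, List.map_ofFn]
  rfl

lemma transferList_append (L L' : List (Fin (m + 1))) :
    transferList d p (L ++ L') = transferList d p L' * transferList d p L := by
  simp [transferList]

lemma transferList_singleton (i : Fin (m + 1)) : transferList d p [i] = transfer d p i := by
  simp [transferList]

lemma listVal_concat (L : List (Fin (m + 1))) (i : Fin (m + 1)) :
    listVal d (L ++ [i]) = d * listVal d L + (i : ℕ) := by
  simp [listVal]

lemma listVal_bounds (L : List (Fin (m + 1))) :
    0 ≤ listVal d L ∧ listVal d L ≤ top d m L.length := by
  induction L using List.reverseRecOn with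
  | nil => simp [listVal, top_zero]
  | append_singleton L i ih =>
    have hi := i.2
    rw [listVal_concat, List.length_append, List.length_singleton, top_succ]
    have h0 : (0 : ℤ) ≤ d := by positivity
    constructor
    · have := mul_nonneg h0 ih.1
      omega
    · have := mul_le_mul_of_nonneg_left ih.2 h0
      omega

lemma halfWidth_eq_one (h : Admissible d m p) : halfWidth d m = 1 := by
  have h1 := h.three_le
  have h2 := h.le
  have h3 := h.lt
  rw [halfWidth, Nat.div_eq_of_lt (by omega)]

lemma sum_matIdx (h : Admissible d m p) (f : ℤ → ℝ) :
    ∑ l : MatIdx d m, f l = f (-1) + f 0 + f 1 := by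
  have : ∑ l : MatIdx d m, f l =
      ∑ l ∈ Finset.Icc (-(halfWidth d m : ℤ)) (halfWidth d m : ℤ), f l :=
    Finset.sum_coe_sort _ f
  rw [this, halfWidth_eq_one h, show Finset.Icc (-((1 : ℕ) : ℤ)) ((1 : ℕ) : ℤ) = {-1, 0, 1} from rfl]
  simp [add_assoc]

lemma matIdx_bounds (h : Admissible d m p) (l : MatIdx d m) : -1 ≤ (l : ℤ) ∧ (l : ℤ) ≤ 1 := by
  have h1 := Finset.mem_Icc.1 l.2
  have h2 : (halfWidth d m : ℤ) = 1 := by exact_mod_cast halfWidth_eq_one h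
  omega

/-- Here e is a digit plus a row index in {-1, 0, 1}. Allowing e outside [0, d) brings in a third
prefix, although at most two terms are nonzero in each case. -/
lemma mass_succ_eq_three (h : Admissible d m p) (n : ℕ) (x : ℤ) {e : ℤ} (he : -1 ≤ e)
    (he' : e ≤ m + 1) :
    mass d p (n + 1) (d * x + e) =
      weightExt p (e + d) * mass d p n (x - 1) + weightExt p e * mass d p n x +
        weightExt p (e - d) * mass d p n (x + 1) := by
  have h1 := h.three_le
  have h2 := h.le
  have h3 := h.lt
  rcases lt_or_ge e 0 with hneg | h0
  · obtain rfl : e = -1 := by omega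
    have := mass_succ h n (x - 1) (r := d - 1) (by omega) (by omega)
    rw [weightExt_of_gt (j := (d : ℤ) - 1 + d) (by omega)] at this
    rw [weightExt_of_neg (j := -1) (by omega), weightExt_of_neg (j := -1 - (d : ℤ)) (by omega),
      show (d : ℤ) * x + -1 = d * (x - 1) + (d - 1) by ring, this,
      show (-1 : ℤ) + d = d - 1 by ring]
    ring
  · rcases lt_or_ge e d with hlt | hge
    · rw [weightExt_of_neg (j := e - d) (by omega), mass_succ h n x h0 hlt]
      ring
    · have := mass_succ h n (x + 1) (r := e - d) (by omega) (by omega)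
      rw [weightExt_of_gt (j := e + d) (by omega),
        show (d : ℤ) * x + e = d * (x + 1) + (e - d) by ring, this, sub_add_cancel,
        add_sub_cancel_right]
      ring

/-- Appending a letter multiplies by a transfer matrix on the left, and this is the one-step
recursion `mass_succ_eq_three` of the masses. -/
lemma transferList_apply (h : Admissible d m p) (L : List (Fin (m + 1))) (κ l : MatIdx d m) :
    transferList d p L κ l =
      mass d p L.length (listVal d L + κ - l * (d : ℤ) ^ L.length) := by
  induction L using List.reverseRecOn generalizing κ with
  | nil =>
    simp only [transferList, List.map_nil, List.reverse_nil, List.prod_nil, List.length_nil,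
      mass_zero, listVal, Matrix.one_apply, Subtype.ext_iff]
    congr 1
    simp [sub_eq_zero]
  | append_singleton L i ih =>
    have hi := i.2
    have hκ := matIdx_bounds h κ
    rw [transferList_append, transferList_singleton, Matrix.mul_apply, List.length_append,
      List.length_singleton, listVal_concat]
    simp only [ih, transfer, Matrix.of_apply]
    rw [sum_matIdx h fun l' : ℤ => weightExt p (-l' * d + κ + (i : ℕ)) *
      mass d p L.length (listVal d L + l' - l * (d : ℤ) ^ L.length)]
    have e : (d : ℤ) * listVal d L + (i : ℕ) + κ - l * (d : ℤ) ^ (L.length + 1) =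
        d * (listVal d L - l * (d : ℤ) ^ L.length) + (κ + (i : ℕ)) := by
      rw [pow_succ]
      ring
    rw [e, mass_succ_eq_three h _ _ (by omega) (by omega)]
    congr 1
    · congr 1
      · congr 2 <;> ring
      · congr 2 <;> ring
    · congr 2 <;> ring

lemma exists_transferList_pow (L : List (Fin (m + 1))) (j : ℕ) :
    ∃ L' : List (Fin (m + 1)), L'.length = L.length * j ∧
      transferList d p L' = transferList d p L ^ j := by
  induction j with
  | zero => exact ⟨[], by simp, by simp [transferList]⟩
  | succ j ih =>
    obtain ⟨L', h1, h2⟩ := ih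
    exact ⟨L ++ L', by rw [List.length_append, h1]; ring, by
      rw [transferList_append, h2, pow_succ]⟩

/-- Row 0 holds the masses at V + d^n, V and V - d^n, where V < 2 d^n is the value of L and n its
length. Two of these make up the folded mass of V modulo d^n. -/
lemma exists_foldMass_le_row_sum (h : Admissible d m p) (L : List (Fin (m + 1))) :
    ∃ κ : MatIdx d m, ∃ y : ℤ, 0 ≤ y ∧ y < (d : ℤ) ^ L.length ∧
      foldMass d p L.length y ≤ ∑ l, |transferList d p L κ l| := by
  obtain ⟨h0, h1⟩ := listVal_bounds (d := d) L
  have htop := top_lt h L.length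
  have hκ : (0 : ℤ) ∈ Finset.Icc (-(halfWidth d m : ℤ)) (halfWidth d m : ℤ) := by simp
  have hsum : ∑ l, |transferList d p L ⟨0, hκ⟩ l| =
      mass d p L.length (listVal d L + (d : ℤ) ^ L.length) + mass d p L.length (listVal d L) +
        mass d p L.length (listVal d L - (d : ℤ) ^ L.length) := by
    simp only [transferList_apply h, abs_of_nonneg (mass_nonneg _ _)]
    rw [sum_matIdx h fun l : ℤ =>
      mass d p L.length (listVal d L + 0 - l * (d : ℤ) ^ L.length)]
    congr 1
    · congr 1 <;> congr 1 <;> ring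
    · congr 1
      ring
  refine ⟨⟨0, hκ⟩, ?_⟩
  rw [hsum]
  have n1 := mass_nonneg (d := d) (p := p) L.length (listVal d L + (d : ℤ) ^ L.length)
  have n2 := mass_nonneg (d := d) (p := p) L.length (listVal d L - (d : ℤ) ^ L.length)
  unfold foldMass
  rcases lt_or_ge (listVal d L) ((d : ℤ) ^ L.length) with hlt | hge
  · exact ⟨_, h0, hlt, by linarith⟩
  · refine ⟨listVal d L - (d : ℤ) ^ L.length, by omega, by omega, ?_⟩
    rw [sub_add_cancel]
    linarith

/-! ### The lower spectral radius -/

/-- The powers of M(σ) belong to the repetitions of σ, and their norms dominate a folded mass. Hence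
the norms are at least p_0^((k+1)j), and for q ≤ 0 their q-th powers are at most `foldSum`;
Gelfand's formula passes to the limit. -/
lemma rho_transferWord_bounds (h : Admissible d m p) {k : ℕ} (σ : Fin (k + 1) → Fin (m + 1)) :
    weight p 0 ≤ rho (transferWord d p σ) ^ (1 / ((k : ℝ) + 1)) ∧
      ∀ {q L : ℝ}, q ≤ 0 → IsGrowth d p q L →
        q * Real.log (rho (transferWord d p σ) ^ (1 / ((k : ℝ) + 1))) ≤ L := by
  have hp0 := weight_pos_zero h
  have hk : (0 : ℝ) < (k : ℝ) + 1 := by positivity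
  obtain ⟨N, hN, hlim⟩ := exists_tendsto_rho (transferWord d p σ)
  have hfold : ∀ j : ℕ, ∃ y : ℤ, 0 ≤ y ∧ y < (d : ℤ) ^ ((k + 1) * j) ∧
      foldMass d p ((k + 1) * j) y ≤ N j := by
    intro j
    obtain ⟨L', hlen, hL'⟩ := exists_transferList_pow (d := d) (p := p) (List.ofFn σ) j
    rw [List.length_ofFn] at hlen
    obtain ⟨κ, y, hy0, hy, hle⟩ := exists_foldMass_le_row_sum h L'
    rw [hlen] at hy hle
    rw [hL', ← transferWord_eq] at hle
    exact ⟨y, hy0, hy, hle.trans (hN j κ)⟩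
  have hlow : ∀ j : ℕ, weight p 0 ^ ((k + 1) * j) ≤ N j := fun j => by
    obtain ⟨y, hy0, hy, hle⟩ := hfold j
    exact (pow_le_foldMass h hy0 hy).trans hle
  have hNpos : ∀ j : ℕ, 0 < N j := fun j => (pow_pos hp0 _).trans_le (hlow j)
  have hrho : weight p 0 ^ (k + 1) ≤ rho (transferWord d p σ) := by
    refine ge_of_tendsto hlim ?_
    filter_upwards [eventually_gt_atTop 0] with j hj
    have h1 := Real.rpow_le_rpow (by positivity) (hlow j) (by positivity : 0 ≤ 1 / (j : ℝ))
    rwa [pow_mul, one_div, Real.pow_rpow_inv_natCast (by positivity) hj.ne', ← one_div] at h1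
  have hrho0 : 0 < rho (transferWord d p σ) := (pow_pos hp0 _).trans_le hrho
  refine ⟨?_, fun {q L} hq hL => ?_⟩
  · have h1 := Real.rpow_le_rpow (by positivity) hrho (by positivity : 0 ≤ 1 / ((k : ℝ) + 1))
    have h2 : 1 / ((k : ℝ) + 1) = ((k + 1 : ℕ) : ℝ)⁻¹ := by push_cast; rw [one_div]
    rw [h2] at h1 ⊢
    rwa [Real.pow_rpow_inv_natCast (by positivity) (by omega)] at h1
  · rw [Real.log_rpow hrho0]
    have hmul : Tendsto (fun j : ℕ => (k + 1) * j) atTop atTop :=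
      tendsto_id.const_mul_atTop' (by omega)
    have h1 := hL.comp hmul
    have h2 := ((Real.continuousAt_log hrho0.ne').tendsto.comp hlim).const_mul (q / ((k : ℝ) + 1))
    have h3 : q * (1 / ((k : ℝ) + 1) * Real.log (rho (transferWord d p σ))) =
        q / ((k : ℝ) + 1) * Real.log (rho (transferWord d p σ)) := by ring
    rw [h3]
    refine le_of_tendsto_of_tendsto h2 h1 ?_
    filter_upwards [eventually_gt_atTop 0] with j hj
    have hj' : (0 : ℝ) < j := by exact_mod_cast hj
    obtain ⟨y, hy0, hy, hle⟩ := hfold j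
    have h4 : N j ^ q ≤ foldSum d p ((k + 1) * j) q :=
      (Real.rpow_le_rpow_of_nonpos (foldMass_pos h hy0 hy) hle hq).trans
        (foldMass_rpow_le_foldSum hy0 hy q)
    have h5 := Real.log_le_log (Real.rpow_pos_of_pos (hNpos j) q) h4
    rw [Real.log_rpow (hNpos j)] at h5
    simp only [Function.comp_apply]
    rw [Real.log_rpow (hNpos j), le_div_iff₀ (by push_cast; positivity)]
    refine le_trans (le_of_eq ?_) h5
    push_cast
    field_simp

lemma rhoLower_set_nonempty (h : Admissible d m p) :
    {x : ℝ | ∃ (k : ℕ) (σ : Fin (k + 1) → Fin (m + 1)), σ 0 ≠ 0 ∧ σ 0 ≠ Fin.last m ∧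
      x = rho (transferWord d p σ) ^ (1 / ((k : ℝ) + 1))}.Nonempty := by
  have h1 := h.three_le
  have h2 := h.le
  refine ⟨_, 0, fun _ => ⟨1, by omega⟩, ?_, ?_, rfl⟩ <;> simp [Fin.ext_iff]
  omega

lemma weight_le_rhoLower (h : Admissible d m p) : weight p 0 ≤ rhoLower d p := by
  refine le_csInf (rhoLower_set_nonempty h) ?_
  rintro _ ⟨k, σ, -, -, rfl⟩
  exact (rho_transferWord_bounds h σ).1

lemma mul_log_rhoLower_le_growth (h : Admissible d m p) {q L : ℝ} (hq : q < 0)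
    (hL : IsGrowth d p q L) : q * Real.log (rhoLower d p) ≤ L := by
  have hp0 := weight_pos_zero h
  have h1 : Real.exp (L / q) ≤ rhoLower d p := by
    refine le_csInf (rhoLower_set_nonempty h) ?_
    rintro _ ⟨k, σ, -, -, rfl⟩
    obtain ⟨h2, h3⟩ := rho_transferWord_bounds h σ
    rw [← Real.le_log_iff_exp_le (hp0.trans_le h2), div_le_iff_of_neg hq, mul_comm]
    exact h3 hq.le hL
  rw [← Real.le_log_iff_exp_le (hp0.trans_le (weight_le_rhoLower h)), div_le_iff_of_neg hq] at h1
  linarith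

lemma exists_list_of_lt (h : Admissible d m p) (b : Fin (m + 1)) (n : ℕ) {y : ℤ} (hy0 : 0 ≤ y)
    (hy : y < (d : ℤ) ^ n) : ∃ L : List (Fin (m + 1)), L.length = n ∧
      listVal d (b :: L) = (d : ℤ) ^ n * (b : ℕ) + y := by
  induction n generalizing y with
  | zero =>
    obtain rfl : y = 0 := by
      rw [pow_zero] at hy
      omega
    exact ⟨[], rfl, by simp [listVal]⟩
  | succ n ih =>
    obtain ⟨a, r, hr0, hr, rfl⟩ := exists_digit h y
    have hle := h.le
    have hd0 : (0 : ℤ) < d := by omega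
    rw [pow_succ] at hy
    have ha0 : 0 ≤ a := by
      by_contra hneg
      have : a ≤ -1 := by omega
      nlinarith
    have ha : a < (d : ℤ) ^ n := by
      by_contra hneg
      have : (d : ℤ) ^ n ≤ a := by omega
      nlinarith
    obtain ⟨L, hlen, hval⟩ := ih ha0 ha
    lift r to ℕ using hr0
    refine ⟨L ++ [⟨r, by omega⟩], by simp [hlen], ?_⟩
    rw [← List.cons_append, listVal_concat, hval, pow_succ]
    ring

/-- Expand y in base d and prepend the digit d - 1, which is neither 0 nor m. The resulting word is
admissible in the infimum, and its row sums are at most a subexponential multiple of the folded mass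
of y. -/
lemma pow_rhoLower_le_foldMass (h : Admissible d m p) (n : ℕ) {y : ℤ} (hy0 : 0 ≤ y)
    (hy : y < (d : ℤ) ^ n) :
    rhoLower d p ^ (n + 1) ≤ 2 * ratioBound p (n + 1) * foldMass d p n y := by
  have h1 := h.three_le
  have h2 := h.le
  have h3 := h.lt
  have hM := pow_pos_int h n
  have hD := one_le_ratioBound h (n + 1)
  set b : Fin (m + 1) := ⟨d - 1, by omega⟩ with hb
  have hbv : (((b : ℕ) : ℕ) : ℤ) = d - 1 := by
    simp only [hb]
    omega
  obtain ⟨L, rfl, hval⟩ := exists_list_of_lt h b n hy0 hy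
  rw [hbv] at hval
  set n := L.length with hn
  set V : ℤ := (d : ℤ) ^ n * ((d : ℤ) - 1) + y with hV
  have hd3 : (3 : ℤ) ≤ d := by omega
  have hV0 : 0 ≤ V := by
    have : 0 ≤ (d : ℤ) ^ n * ((d : ℤ) - 1) := mul_nonneg hM.le (by omega)
    omega
  have hVd : V < (d : ℤ) ^ (n + 1) := by
    rw [pow_succ]
    linarith
  have hVtop : V ≤ top d m (n + 1) := by
    have := pow_le_top_add_one h (n + 1)
    omega
  have hmV : mass d p (n + 1) V ≤ foldMass d p n y := by
    have := (mass_block_comparable h (s := 1) (t := (d : ℤ) - 1) (by omega)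
      (by rw [top_one]; omega) hy0 hy).1
    rwa [add_comm 1 n] at this
  have hmV0 : 0 ≤ mass d p (n + 1) V := mass_nonneg _ _
  -- The leading digit d - 1 and m ≤ 2d - 3 push V + κ + d^(n+1) out of range for every row index κ
  -- ≥ -1.
  have hfar : top d m (n + 1) < V + (d : ℤ) ^ (n + 1) - 1 := by
    have e1 := top_mul (d := d) (m := m) (n + 1)
    have hm : (m : ℤ) ≤ 2 * d - 3 := by omega
    have e2 : (m : ℤ) * ((d : ℤ) ^ (n + 1) - 1) ≤ (2 * d - 3) * ((d : ℤ) ^ (n + 1) - 1) :=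
      mul_le_mul_of_nonneg_right hm (by
        have := pow_pos_int h (n + 1)
        omega)
    by_contra hcon
    have e3 : (V + (d : ℤ) ^ (n + 1) - 1) * ((d : ℤ) - 1) ≤ top d m (n + 1) * ((d : ℤ) - 1) :=
      mul_le_mul_of_nonneg_right (by omega) (by omega)
    have e4 : (d : ℤ) ^ (n + 1) = (d : ℤ) ^ n * d := pow_succ _ _
    have e5 : 0 ≤ y * ((d : ℤ) - 1) := mul_nonneg hy0 (by omega)
    rw [hV, e4] at e3
    rw [e4] at e1 e2
    nlinarith
  have hrow : ∀ κ, ∑ l, |transferList d p (b :: L) κ l| ≤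
      2 * ratioBound p (n + 1) * foldMass d p n y := by
    intro κ
    obtain ⟨κ1, κ2⟩ := matIdx_bounds h κ
    simp only [transferList_apply h, abs_of_nonneg (mass_nonneg _ _), List.length_cons, hval]
    rw [sum_matIdx h fun l : ℤ => mass d p (n + 1) (V + κ - l * (d : ℤ) ^ (n + 1))]
    have t1 : mass d p (n + 1) (V + κ - -1 * (d : ℤ) ^ (n + 1)) = 0 :=
      mass_eq_zero_of_gt (by linarith)
    have t2 : mass d p (n + 1) (V + κ - 0 * (d : ℤ) ^ (n + 1)) ≤
        ratioBound p (n + 1) * mass d p (n + 1) V := by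
      have := mass_le_of_dist h (n + 1) 1 (i := V + κ - 0 * (d : ℤ) ^ (n + 1)) hV0 hVtop (by
        rw [abs_le]
        push_cast
        constructor <;> linarith)
      rwa [pow_one] at this
    have t3 : mass d p (n + 1) (V + κ - 1 * (d : ℤ) ^ (n + 1)) ≤ mass d p (n + 1) V := by
      rcases lt_or_ge (V + κ - 1 * (d : ℤ) ^ (n + 1)) 0 with hlt | hge
      · rw [mass_eq_zero_of_neg hlt]
        exact hmV0
      -- Since V < d^(n+1) and κ ≤ 1, the only nonnegative possibility is the left endpoint, where
      -- the mass is minimal.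
      · have : V + κ - 1 * (d : ℤ) ^ (n + 1) = 0 := by omega
        rw [this, mass_first h]
        exact pow_le_mass h hV0 hVtop
    rw [t1, zero_add]
    have t4 : mass d p (n + 1) V ≤ ratioBound p (n + 1) * mass d p (n + 1) V :=
      le_mul_of_one_le_left hmV0 hD
    have t5 := mul_le_mul_of_nonneg_left hmV (by linarith : 0 ≤ ratioBound p (n + 1))
    linarith
  have hκ : Nonempty (MatIdx d m) := ⟨⟨0, by simp⟩⟩
  have hfold := foldMass_nonneg (d := d) (p := p) n y
  have hrho := rho_le_of_row_sum_le _ (by positivity) hrow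
  set σ : Fin (n + 1) → Fin (m + 1) := (b :: L).get with hσ
  have hword : transferWord d p σ = transferList d p (b :: L) := by
    rw [transferWord_eq]
    congr 1
    exact List.ofFn_get (b :: L)
  have hle : rhoLower d p ≤ rho (transferWord d p σ) ^ (1 / ((n : ℝ) + 1)) := by
    refine csInf_le ⟨0, ?_⟩ ⟨n, σ, ?_, ?_, rfl⟩
    · rintro _ ⟨k, τ, -, -, rfl⟩
      exact Real.rpow_nonneg (rho_nonneg _) _
    · change b ≠ 0
      simp only [hb, ne_eq, Fin.ext_iff, Fin.val_zero]
      omega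
    · change b ≠ Fin.last m
      simp only [hb, ne_eq, Fin.ext_iff, Fin.val_last]
      omega
  have hpow := pow_le_pow_left₀ ((weight_nonneg 0).trans (weight_le_rhoLower h)) hle (n + 1)
  have e : 1 / ((n : ℝ) + 1) = ((n + 1 : ℕ) : ℝ)⁻¹ := by push_cast; rw [one_div]
  rw [e, Real.rpow_inv_natCast_pow (rho_nonneg _) (by omega), hword] at hpow
  exact hpow.trans hrho

lemma growth_le_rhoLower (h : Admissible d m p) {q L : ℝ} (hq : q ≤ 0) (hL : IsGrowth d p q L) :
    L ≤ Real.log d + q * Real.log (rhoLower d p) :=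
  growth_le_of_le_foldMass h hL hq ((weight_pos_zero h).trans_le (weight_le_rhoLower h))
    fun n _ hy0 hy => pow_rhoLower_le_foldMass h n hy0 hy

lemma delta_neg (h : Admissible d m p) : delta d < 0 :=
  div_neg_of_neg_of_pos (by norm_num) (log_base_pos h)

end

end OverlapIFS

/-! ### The main theorem. -/

theorem theorem3 (d m : ℕ) (hd : 3 ≤ d) (hdm : d ≤ m) (hmd : m + 2 < 2 * d)
    (p : PMF (Fin (m + 1)))
    (hp_pos : 0 < p 0)
    (hp_last : p 0 ≤ p (Fin.last m))
    (hp_mid : ∀ i : Fin (m + 1), i ≠ 0 → i ≠ Fin.last m → p (Fin.last m) ≤ p i)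
    (Ξ : (k : ℕ) → Finset (Fin k → Fin (m + 1)))
    (hΞ : OverlapIFS.IsRepresentativeFamily d m Ξ)
    (ℓ : ℕ) (w : Fin ℓ → Fin (m + 1)) (hw : OverlapIFS.IsBarrier d w) :
    ∃ τ τhat : ℝ → ℝ,
      -- the limit defining `τhat` exists and equals the infimum
      (∀ q : ℝ,
        Tendsto (fun n : ℕ => OverlapIFS.delta d * ((ℓ : ℝ) + (n : ℝ))⁻¹ *
            Real.log (OverlapIFS.Shat d p w Ξ n q)) atTop (𝓝 (τhat q)) ∧
        IsGLB (Set.range fun n : ℕ => OverlapIFS.delta d * ((ℓ : ℝ) + (n : ℝ))⁻¹ *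
            Real.log (OverlapIFS.Shat d p w Ξ n q)) (τhat q)) ∧
      -- `τhat` is the spectrum of the restriction to any closed interval inside `(0, ξ)`
      (∀ u v : ℝ, 0 < u → u < v → v < OverlapIFS.xi d m →
        OverlapIFS.IsLqSpectrum ((OverlapIFS.selfSimilar d p).restrict (Set.Icc u v)) τhat) ∧
      -- the spectrum `τ` of the measure itself
      OverlapIFS.IsLqSpectrum (OverlapIFS.selfSimilar d p) τ ∧
      (OverlapIFS.alphaStar d p = OverlapIFS.alphaBar d p → ∀ q : ℝ, τ q = τhat q) ∧
      (OverlapIFS.alphaStar d p < OverlapIFS.alphaBar d p →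
        ∃ q₀ : ℝ, q₀ < 0 ∧
          (∀ q : ℝ, q ≤ q₀ → τ q = OverlapIFS.alphaBar d p * q) ∧
          (∀ q : ℝ, q₀ < q → τ q = τhat q)) := by

  have h : OverlapIFS.Admissible d m p := ⟨hd, hdm, hmd, hp_pos, hp_last, hp_mid⟩
  have hxi := OverlapIFS.xi_bounds h
  have hδ := OverlapIFS.delta_neg h
  obtain ⟨hu, hv⟩ := OverlapIFS.barrier_bounds hd hw
  have hℓ := OverlapIFS.barrier_length_pos h hw
  have huv : OverlapIFS.projFin d w <
      OverlapIFS.projFin d w + OverlapIFS.xi d m / (d : ℝ) ^ ℓ := by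
    have := OverlapIFS.one_le_pow_real h ℓ
    have : 0 < OverlapIFS.xi d m / (d : ℝ) ^ ℓ := div_pos (by linarith) (by linarith)
    linarith
  have hne : ∀ n, ℓ ≤ n → (OverlapIFS.window d m (OverlapIFS.projFin d w)
      (OverlapIFS.projFin d w + OverlapIFS.xi d m / (d : ℝ) ^ ℓ) n).Nonempty := by
    intro n hn
    obtain ⟨k, rfl⟩ := Nat.exists_eq_add_of_le hn
    exact ⟨_, (OverlapIFS.mem_barrier_window h w k _).2
      ⟨le_rfl, le_add_of_nonneg_right (OverlapIFS.top_nonneg k)⟩⟩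
  choose P hP hPle using fun q => OverlapIFS.exists_growth h hu huv hv hℓ hne q
  have hPlast : ∀ q, 0 ≤ q → q * Real.log (OverlapIFS.weight p 0) ≤ P q :=
    fun q hq => OverlapIFS.mul_log_first_le_growth h (hP q) hq
  have hShat : ∀ (q : ℝ) (n : ℕ), OverlapIFS.delta d * ((ℓ : ℝ) + (n : ℝ))⁻¹ *
      Real.log (OverlapIFS.Shat d p w Ξ n q) = OverlapIFS.delta d *
        (Real.log (OverlapIFS.windowSum d p (OverlapIFS.projFin d w)
          (OverlapIFS.projFin d w + OverlapIFS.xi d m / (d : ℝ) ^ ℓ) (ℓ + n) q) /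
            ((ℓ + n : ℕ) : ℝ)) := by
    intro q n
    rw [OverlapIFS.Shat_eq_windowSum h hΞ]
    push_cast
    ring
  have htendsto : ∀ q, Tendsto (fun n : ℕ => OverlapIFS.delta d * ((ℓ : ℝ) + (n : ℝ))⁻¹ *
      Real.log (OverlapIFS.Shat d p w Ξ n q)) atTop (𝓝 (OverlapIFS.delta d * P q)) := by
    intro q
    have h1 := (OverlapIFS.tendsto_windowSum_iff h (by linarith) huv (by linarith)).2 (hP q)
    have h2 : Tendsto (fun n : ℕ => ℓ + n) atTop atTop :=
      tendsto_atTop_mono (fun n => Nat.le_add_left n ℓ) tendsto_id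
    exact ((h1.comp h2).const_mul (OverlapIFS.delta d)).congr fun n => (hShat q n).symm
  -- Since δ < 0, this is the minimum of τhat(q) and ᾱ q.
  refine ⟨fun q => OverlapIFS.delta d * max (P q) (q * Real.log (OverlapIFS.weight p 0)),
    fun q => OverlapIFS.delta d * P q, fun q => ⟨htendsto q, ?_, ?_⟩, ?_, ?_, ?_, ?_⟩
  · rintro _ ⟨n, rfl⟩
    simp only [hShat]
    exact mul_le_mul_of_nonpos_left (hPle q (ℓ + n) (Nat.le_add_right _ _)) hδ.le
  · intro b hb
    exact ge_of_tendsto' (htendsto q) fun n => hb ⟨n, rfl⟩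
  · intro u v hu0 huv' hv' q
    exact OverlapIFS.tendsto_packingSum h hu0.le huv' hv'.le
      ((OverlapIFS.tendsto_windowSum_iff h hu0 huv' hv').2 (hP q))
  · intro q
    have h1 := OverlapIFS.tendsto_fullSum h (hP q)
    have h2 := OverlapIFS.tendsto_packingSum h le_rfl (by linarith) le_rfl (q := q)
      (h1.congr fun n => by
        rw [OverlapIFS.fullSum, OverlapIFS.windowSum, OverlapIFS.window_full h])
    rwa [OverlapIFS.selfSimilar_restrict_full hd] at h2
  · intro hα q
    rcases lt_or_ge q 0 with hq | hq
    · have h1 := OverlapIFS.mul_log_rhoLower_le_growth h hq (hP q)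
      rw [mul_left_cancel₀ hδ.ne hα] at h1
      simp only [max_eq_left h1]
    · simp only [max_eq_left (hPlast q hq)]
  · intro hα
    have hlog : Real.log (OverlapIFS.weight p 0) < Real.log (OverlapIFS.rhoLower d p) :=
      lt_of_mul_lt_mul_of_nonpos_left hα hδ.le
    have hlogd := OverlapIFS.log_base_pos h
    obtain ⟨q₀, hq₀, hle, hge⟩ := OverlapIFS.exists_threshold (P := P)
      (c := Real.log (OverlapIFS.weight p 0))
      (fun q q' hq => OverlapIFS.growth_antitone h (hP q) (hP q') hq)
      (fun q q' hq => OverlapIFS.growth_lipschitz h (hP q) (hP q') hq)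
      (by rw [OverlapIFS.growth_zero_exponent (hP 0)]; exact hlogd) (by
        set g := Real.log (OverlapIFS.rhoLower d p) - Real.log (OverlapIFS.weight p 0) with hg
        have hg0 : 0 < g := sub_pos.2 hlog
        have hq : -(Real.log d / g) ≤ 0 := neg_nonpos.2 (by positivity)
        -- At this exponent the upper bound log d + q log ρ_* equals q log p_0.
        refine ⟨-(Real.log d / g), ?_⟩
        have h1 := OverlapIFS.growth_le_rhoLower h hq (hP _)
        have h2 : Real.log d / g * g = Real.log d := by field_simp
        rw [hg] at h2
        linarith)
    refine ⟨q₀, hq₀, fun q hq => ?_, fun q hq => ?_⟩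
    · simp only [max_eq_right (hle q hq), OverlapIFS.alphaBar]
      ring
    · simp only [max_eq_left (hge q hq)]
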